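/- **Setting.** Let $P\ge 1$ clients hold datasets $D_p=(z^{(p)}_1,\dots,z^{(p)}_{n_p})$, $p\in[P]$, and put $n_{\min}=\min_p n_p$. Let $\ell(x,z)$ be a loss, $x\in\mathbb R^d$, with gradient $\nabla\ell$ in $x$. A randomized mechanism $\mathcal M(D_1,\dots,D_P)$ is $(\varepsilon,\delta)$-DP with respect to $D_p$ if $\mathbb P(\mathcal M(\mathcal D)\in S)\le e^{\varepsilon}\,\mathbb P(\mathcal M(\mathcal D')\in S)+\delta$ for all measurable $S$ and all $\mathcal D,\mathcal D'$ which agree except that $D_p$ and $D_p'$ differ in exactly one record. For a finite family, let $\mathrm{ClippedMean}(\{y_i\}_{i\in I},C)=\frac1{|I|}\sum_{i\in I}\min\{C/\|y_i\|,1\}\,y_i$. **Algorithm (DIFF2 with the BVR-L-SGD routine).** The parameters are integers $T,R,K\ge 1$ and $1\le b\le n_{\min}$, clipping radii $C_1,C_2,C_3>0$, $\eta\in\mathbb R$, $x_0\in\mathbb R^d$ and noise multipliers $\sigma_1,\sigma_2,\sigma_3$. For $r=1,\dots,R$: 1. If $T\mid r-1$, put $d_r^{(p)}=\mathrm{ClippedMean}(\{\nabla\ell(x_{r-1},z)\}_{z\in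 D_p},C_1)$ for all $p$ and $\widetilde v_r=\frac1P\sum_p d_r^{(p)}+\xi_r$ with $\xi_r\sim N(0,\sigma_1^2C_1^2I)$. Otherwise put $C_{2,r}=C_2\|x_{r-1}-x_{r-2}\|$, $d_r^{(p)}=\mathrm{ClippedMean}(\{\nabla\ell(x_{r-1},z)-\nabla\ell(x_{r-2},z)\}_{z\in D_p},C_{2,r})$ and $\widetilde v_r=\frac1P\sum_p d_r^{(p)}+\widetilde v_{r-1}+\xi_r$ with $\xi_r\sim N(0,\sigma_2^2C_{2,r}^2I)$. 2. Put $x_{0,r-1}=x_{r-1}$, $\widetilde v_{1,r}=\widetilde v_r$, $x_{1,r-1}=x_{0,r-1}-\eta\widetilde v_{1,r}$ and $p_r=1+(r\bmod P)$. For $k=2,\dots,K$ draw a uniformly random subset $I_{k,r}$ of size $b$ of $D_{p_r}$ without replacement, put $C_{3,k,r}=C_3\|x_{k-1,r-1}-x_{k-2,r-1}\|$, $\widetilde v_{k,r}=\mathrm{ClippedMean}(\{\nabla\ell(x_{k-1,r-1},z)-\nabla\ell(x_{k-2,r-1},z)\}_{z\in I_{k,r}},C_{3,k,r})+\widetilde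 v_{k-1,r}+\xi_{k,r}$ with $\xi_{k,r}\sim N(0,\sigma_3^2C_{3,k,r}^2I)$, and $x_{k,r-1}=x_{k-1,r-1}-\eta\widetilde v_{k,r}$. 3. Put $x_r=x_{K,r-1}$ and $x_r^{\mathrm{out}}=x_{\hat k,r-1}$ with $\hat k$ uniform on $\{1,\dots,K\}$. All random draws are fresh and independent. Let $\mathcal M$ be the mechanism that outputs $\{x_r,x_r^{\mathrm{out}},\widetilde v_r\}_{r\in[R]}$. For $\gamma\in(0,1]$, $\sigma_3>0$ and an integer $\alpha\ge 2$ put $\varepsilon(j)=2j/(b^2\sigma_3^2)$ (so $\varepsilon(\infty)=\infty$) and $$\varepsilon'_\gamma(\alpha)=\frac1{\alpha-1}\log\Big(1+\gamma^2\binom\alpha2\min\big\{4(e^{\varepsilon(2)}-1),\,e^{\varepsilon(2)}\min\{2,(e^{\varepsilon(\infty)}-1)^2\}\big\}+\sum_{j=3}^{\alpha}\gamma^j\binom\alpha j e^{(j-1)\varepsilon(j)}\min\{2,(e^{\varepsilon(\infty)}-1)^j\}\Big).$$ **Proposition.** (a) Let $\sigma_1,\sigma_2,\sigma_3>0$ and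 $\delta\in(0,1)$. For every integer $\alpha\ge2$ and every $p\in[P]$, $\mathcal M$ is, with respect to $D_p$, $$\Big(\frac{2\alpha\lceil R/T\rceil}{n_p^2P^2\sigma_1^2}+\frac{2\alpha(R-\lceil R/T\rceil)}{n_p^2P^2\sigma_2^2}+K\Big\lceil\frac RP\Big\rceil\varepsilon'_{b/n_p}(\alpha)+\frac{\log(1/\delta)}{\alpha-1},\ \delta\Big)\text{-DP}.$$ (b) Let $\varepsilon_{\mathrm{DP}}>0$, $\delta_{\mathrm{DP}}\in(0,1)$, $\alpha=1+\lceil 2\log(1/\delta_{\mathrm{DP}})/\varepsilon_{\mathrm{DP}}\rceil$, $u_1,u_2>1$, $\sigma_1,\sigma_2\ge 0$ and $\sigma_3>0$. If $$\sigma_1^2=\frac{4u_1\alpha\lceil R/T\rceil}{n_{\min}^2P^2\varepsilon_{\mathrm{DP}}},\quad \sigma_2^2=\frac{4u_2\alpha(R-\lceil R/T\rceil)}{n_{\min}^2P^2\varepsilon_{\mathrm{DP}}},\quad 2K\Big\lceil\frac RP\Big\rceil\varepsilon'_{b/n_{\min}}(\alpha)\le\Big(1-\frac1{u_1}-\frac1{u_2}\Big)\varepsilon_{\mathrm{DP}},\qquad(\ast)$$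 then $\mathcal M$ is $(\varepsilon_{\mathrm{DP}},\delta_{\mathrm{DP}})$-DP with respect to every $D_p$. (c) Fix $u_1,u_2>1$ with $1/u_1+1/u_2<1$, $\bar\varepsilon>0$ and $\bar\delta\in(0,1)$. There are constants $c,C>0$ which depend only on $u_1,u_2,\bar\varepsilon,\bar\delta$ such that the following holds whenever $T\le R$, $P\le R$, $0<\varepsilon_{\mathrm{DP}}\le\bar\varepsilon$ and $0<\delta_{\mathrm{DP}}\le\bar\delta$, with $\alpha$ as in (b). Write $A\asymp B$ for $c\log(1/\delta_{\mathrm{DP}})B\le A\le C\log(1/\delta_{\mathrm{DP}})B$. There are $\sigma_1>0$, $\sigma_2\ge0$, $s_3>0$, where $\sigma_1^2,\sigma_2^2$ are given by the formulas in $(\ast)$, with $$\sigma_1^2\asymp\frac{R}{Tn_{\min}^2P^2\varepsilon_{\mathrm{DP}}^2},\qquad \sigma_2^2\asymp\frac{R}{n_{\min}^2P^2\varepsilon_{\mathrm{DP}}^2},\qquad s_3^2\asymp\frac{KR}{n_{\min}^2P\varepsilon_{\mathrm{DP}}^2}\vee\frac1{b^2\varepsilon_{\mathrm{DP}}}$$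 (the lower bound on $\sigma_2^2$ only if $T\ge2$; for $T=1$, $\sigma_2=0$ is not used), such that for every $\sigma_3\ge s_3$, in particular for $\sigma_3=s_3$, the condition $b\le\min\{n_{\min}/(2e\alpha),\,(4n_{\min}/(\alpha\sigma_3^2))^{1/3}\}$ implies $(\ast)$, and therefore that $\mathcal M$ is $(\varepsilon_{\mathrm{DP}},\delta_{\mathrm{DP}})$-DP with respect to every $D_p$. -/

import Mathlib

open MeasureTheory ProbabilityTheory

universe u

namespace DIFF2

/-! ### Differential privacy with respect to one local dataset -/

/-- Two datasets of the same size are adjacent if they differ in exactly one record. -/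
def Adjacent {m : ℕ} {Z : Type*} (D D' : Fin m → Z) : Prop :=
  open scoped Classical in hammingDist D D' = 1

/-- `IsDP M p ε δ`: the mechanism `M`, which sends the collection `(D_1, …, D_P)` of local datasets
to the law of its output, is `(ε, δ)`-differentially private with respect to the `p`-th dataset. -/
def IsDP {P : ℕ} {n : Fin P → ℕ} {Z Y : Type*} [MeasurableSpace Y]
    (M : (∀ q, Fin (n q) → Z) → Measure Y) (p : Fin P) (ε δ : ℝ) : Prop :=
  ∀ D D' : ∀ q, Fin (n q) → Z, (∀ q, q ≠ p → D q = D' q) → Adjacent (D p) (D' p) →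
    ∀ S : Set Y, MeasurableSet S →
      M D S ≤ ENNReal.ofReal (Real.exp ε) * M D' S + ENNReal.ofReal δ

/-! ### The subsampled RDP bound -/

/-- The subsampled RDP level of order `α` for subsampling without replacement with ratio `γ`, when
the base mechanism has RDP level `ε j` at order `j` and `εtop` at order `∞`:
`1/(α-1) * log (1 + γ² (α choose 2) min {4(e^ε(2) - 1), e^ε(2) min {2, (e^ε(∞) - 1)²}}
  + ∑_{j=3}^α γ^j (α choose j) e^((j-1)ε(j)) min {2, (e^ε(∞) - 1)^j})`.
The factors `min {2, (e^ε(∞) - 1)^j}` are formed in `[0, ∞]`, and are finite. -/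
noncomputable def subsampledRDP (γ : ℝ) (ε : ℕ → ℝ) (εtop : EReal) (α : ℕ) : ℝ :=
  let cap : ℕ → ℝ := fun j => (min 2 ((EReal.exp εtop - 1) ^ j)).toReal
  1 / ((α : ℝ) - 1) * Real.log (1
    + γ ^ 2 * (α.choose 2 : ℝ) * min (4 * (Real.exp (ε 2) - 1)) (Real.exp (ε 2) * cap 2)
    + ∑ j ∈ Finset.Icc 3 α,
        γ ^ j * (α.choose j : ℝ) * Real.exp (((j : ℝ) - 1) * ε j) * cap j)

/-- The level `ε'(α)` for the base levels `ε(α) = 2α/(b²σ₃²)`, so `ε(∞) = ∞`. -/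
noncomputable def epsPrime (γ : ℝ) (b : ℕ) (σ₃ : ℝ) (α : ℕ) : ℝ :=
  subsampledRDP γ (fun j => 2 * (j : ℝ) / ((b : ℝ) ^ 2 * σ₃ ^ 2)) ⊤ α

/-- The smallest local sample size `n_min`. -/
noncomputable def nMin {P : ℕ} (n : Fin P → ℕ) : ℕ := ⨅ p, n p

/-! ### Clipping -/

/-- The parameter space `ℝ^d` with the Euclidean norm. -/
abbrev Vec (d : ℕ) := EuclideanSpace ℝ (Fin d)

/-- `min {C/‖x‖, 1} x`, which is `0` at `x = 0`. -/
noncomputable def clip {d : ℕ} (C : ℝ) (x : Vec d) : Vec d := min (C / ‖x‖) 1 • x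

/-- The mean over `i ∈ I` of the vectors `g i`, clipped at radius `C`. -/
noncomputable def clippedMean {d : ℕ} {ι : Type*} (I : Finset ι) (g : ι → Vec d) (C : ℝ) : Vec d :=
  (1 / (I.card : ℝ)) • ∑ i ∈ I, clip C (g i)

/-! ### The program variables and assignments -/

/-- The variables of the algorithm: `x k r` is the iterate `x_{k,r}` (with `x_r = x_{0,r}`), `v k r`
is the noisy estimator `ṽ_{k,r}` (with `ṽ_r = ṽ_{1,r}`), and `out r` is `x_r^out`. -/
inductive Slot
  | x (k r : ℕ)
  | v (k r : ℕ)
  | out (r : ℕ)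
deriving DecidableEq

/-- The values of all the variables. -/
abbrev Memory (d : ℕ) := Slot → Vec d

/-- The randomized assignment `y := F (memory, w)` with a fresh random `w ∼ ν`. -/
noncomputable def assign {d : ℕ} {W : Type*} [MeasurableSpace W] (ν : Measure W) [SFinite ν]
    (y : Slot) (F : Memory d × W → Vec d) (hF : Measurable F) :
    Kernel (Memory d) (Memory d) where
  toFun := fun s => ν.map fun w => Function.update s y (F (s, w))
  measurable' := by
    have h : Measurable fun q : Memory d × W => Function.update q.1 y (F q) :=
      measurable_update'.comp (measurable_fst.prodMk hF)
    refine Measure.measurable_of_measurable_coe _ fun A hA => ?_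
    have e : ∀ s : Memory d, (ν.map fun w => Function.update s y (F (s, w))) A
        = ν (Prod.mk s ⁻¹' ((fun q : Memory d × W => Function.update q.1 y (F q)) ⁻¹' A)) :=
      fun _ => Measure.map_apply (h.comp measurable_prodMk_left) hA
    simp only [e]
    exact measurable_measure_prodMk_left (h hA)

instance {d : ℕ} {W : Type*} [MeasurableSpace W] (ν : Measure W) [IsProbabilityMeasure ν]
    (y : Slot) (F : Memory d × W → Vec d) (hF : Measurable F) :
    IsMarkovKernel (assign ν y F hF) where
  isProbabilityMeasure s :=
    Measure.isProbabilityMeasure_map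
      ((measurable_update'.comp (measurable_fst.prodMk hF)).comp
        measurable_prodMk_left).aemeasurable

/-! ### The hyperparameters -/

/-- The loss and the hyperparameters of the algorithm other than the noise multipliers, for
local datasets of sizes `n p`. -/
structure Config (d : ℕ) {P : ℕ} (n : Fin P → ℕ) (Z : Type*) where
  /-- the loss `ℓ(x, z)` -/
  loss : Vec d → Z → ℝ
  /-- the initial point -/
  x₀ : Vec d
  /-- the step size -/
  η : ℝ
  /-- the clipping radii -/
  C₁ : ℝ
  C₂ : ℝ
  C₃ : ℝ
  /-- the restart interval -/
  T : ℕ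
  /-- the number of rounds -/
  R : ℕ
  /-- the number of local iterations -/
  K : ℕ
  /-- the minibatch size -/
  b : ℕ
  C₁_pos : 0 < C₁
  C₂_pos : 0 < C₂
  C₃_pos : 0 < C₃
  T_pos : 1 ≤ T
  R_pos : 1 ≤ R
  K_pos : 1 ≤ K
  b_pos : 1 ≤ b
  b_le : ∀ p, b ≤ n p

/-! ### Measurability of the building blocks -/

section Measurability

variable {d : ℕ} {Z : Type*}

/-- The sample gradient `∇ℓ(·, z)` at `x`. -/
noncomputable def grad (loss : Vec d → Z → ℝ) (x : Vec d) (z : Z) : Vec d :=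
  gradient (fun y => loss y z) x

@[fun_prop]
lemma measurable_grad (loss : Vec d → Z → ℝ) (z : Z) : Measurable fun x => grad loss x z := by
  unfold grad gradient
  exact (LinearIsometryEquiv.continuous _).measurable.comp (measurable_fderiv ℝ _)

lemma measurable_clippedMean {α ι : Type*} [MeasurableSpace α] (I : Finset ι)
    {g : α → ι → Vec d} (hg : ∀ i, Measurable fun a => g a i) {C : α → ℝ} (hC : Measurable C) :
    Measurable fun a => clippedMean I (g a) (C a) := by
  unfold clippedMean clip
  have h : ∀ i, Measurable fun a => min (C a / ‖g a i‖) 1 • g a i := fun i =>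
    ((hC.div (hg i).norm).min measurable_const).smul (hg i)
  fun_prop

end Measurability

/-! ### The algorithm -/

section Algorithm

variable {d P : ℕ} {n : Fin P → ℕ} {Z : Type*}

/-- `v_r` minus the noise: the estimator that the server computes in round `r` before it adds
noise; restart rounds are those with `(r - 1) % T = 0`. -/
noncomputable def serverMean (A : Config d n Z) (D : ∀ p, Fin (n p) → Z) (r : ℕ)
    (s : Memory d) : Vec d :=
  if (r - 1) % A.T = 0 then
    (1 / (P : ℝ)) • ∑ p, clippedMean Finset.univ
      (fun i => grad A.loss (s (.x 0 (r - 1))) (D p i)) A.C₁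
  else
    (1 / (P : ℝ)) • ∑ p, clippedMean Finset.univ
      (fun i => grad A.loss (s (.x 0 (r - 1))) (D p i) - grad A.loss (s (.x 0 (r - 2))) (D p i))
      (A.C₂ * ‖s (.x 0 (r - 1)) - s (.x 0 (r - 2))‖)
    + s (.v 1 (r - 1))

/-- The standard deviation `σ C` of the server noise in round `r`. -/
noncomputable def serverStd (A : Config d n Z) (σ₁ σ₂ : ℝ) (r : ℕ) (s : Memory d) : ℝ :=
  if (r - 1) % A.T = 0 then σ₁ * A.C₁
  else σ₂ * (A.C₂ * ‖s (.x 0 (r - 1)) - s (.x 0 (r - 2))‖)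

lemma measurable_serverMean (A : Config d n Z) (D : ∀ p, Fin (n p) → Z) (r : ℕ) :
    Measurable (serverMean A D r) := by
  unfold serverMean
  split_ifs
  · have h : ∀ p, Measurable fun s : Memory d => clippedMean Finset.univ
        (fun i => grad A.loss (s (.x 0 (r - 1))) (D p i)) A.C₁ :=
      fun p => measurable_clippedMean _ (fun i => by fun_prop) measurable_const
    fun_prop
  · have h : ∀ p, Measurable fun s : Memory d => clippedMean Finset.univ
        (fun i => grad A.loss (s (.x 0 (r - 1))) (D p i)
          - grad A.loss (s (.x 0 (r - 2))) (D p i))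
        (A.C₂ * ‖s (.x 0 (r - 1)) - s (.x 0 (r - 2))‖) :=
      fun p => measurable_clippedMean _ (fun i => by fun_prop) (by fun_prop)
    fun_prop

lemma measurable_serverStd (A : Config d n Z) (σ₁ σ₂ : ℝ) (r : ℕ) :
    Measurable (serverStd A σ₁ σ₂ r) := by
  unfold serverStd
  split_ifs <;> fun_prop

/-- `ṽ_{1,r} := ṽ_r := v_r + ξ_r` with `ξ_r ∼ N(0, σ² C² I)`. -/
noncomputable def serverStep (A : Config d n Z) (σ₁ σ₂ : ℝ) (D : ∀ p, Fin (n p) → Z) (r : ℕ) :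
    Kernel (Memory d) (Memory d) :=
  assign (stdGaussian (Vec d)) (.v 1 r)
    (fun q => serverMean A D r q.1 + serverStd A σ₁ σ₂ r q.1 • q.2)
    (((measurable_serverMean A D r).comp measurable_fst).add
      (((measurable_serverStd A σ₁ σ₂ r).comp measurable_fst).smul measurable_snd))

/-- `x_{k,r-1} := x_{k-1,r-1} - η ṽ_{k,r}`. -/
noncomputable def descentStep (A : Config d n Z) (k r : ℕ) : Kernel (Memory d) (Memory d) :=
  assign (Measure.dirac ()) (.x k (r - 1))
    (fun q => q.1 (.x (k - 1) (r - 1)) - A.η • q.1 (.v k r)) (by fun_prop)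

/-- The client `p_r = 1 + r % P` of round `r` (here the clients are numbered from `0`). -/
def client (P : ℕ) [NeZero P] (r : ℕ) : Fin P := Fin.ofNat P r

/-- The radius `C_{3,k,r} = C₃ ‖x_{k-1,r-1} - x_{k-2,r-1}‖`. -/
noncomputable def localRadius (A : Config d n Z) (k r : ℕ) (s : Memory d) : ℝ :=
  A.C₃ * ‖s (.x (k - 1) (r - 1)) - s (.x (k - 2) (r - 1))‖

/-- The estimator `v_{k,r}` on the local dataset `Dp` with the minibatch of indices `I`. -/
noncomputable def localMean (A : Config d n Z) {m : ℕ} (Dp : Fin m → Z) (k r : ℕ)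
    (s : Memory d) (I : Finset (Fin m)) : Vec d :=
  clippedMean I
    (fun i => grad A.loss (s (.x (k - 1) (r - 1))) (Dp i)
      - grad A.loss (s (.x (k - 2) (r - 1))) (Dp i))
    (localRadius A k r s)
  + s (.v (k - 1) r)

lemma measurable_localRadius (A : Config d n Z) (k r : ℕ) :
    Measurable (localRadius (d := d) A k r) := by
  unfold localRadius
  fun_prop

lemma measurable_localMean (A : Config d n Z) {m : ℕ} (Dp : Fin m → Z) (k r : ℕ) :
    Measurable fun q : Memory d × Finset (Fin m) => localMean A Dp k r q.1 q.2 := by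
  refine measurable_from_prod_countable_left fun I => ?_
  unfold localMean
  exact (measurable_clippedMean I (fun i => by fun_prop) (measurable_localRadius A k r)).add
    (measurable_pi_apply _)

/-- The uniform distribution on the subsets of size `b` of the index set of a local dataset. -/
noncomputable def minibatchLaw (m b : ℕ) : Measure (Finset (Fin m)) :=
  uniformOn {I : Finset (Fin m) | I.card = b}

instance (m b : ℕ) : IsFiniteMeasure (minibatchLaw m b) := by
  unfold minibatchLaw; infer_instance

/-- `ṽ_{k,r} := v_{k,r} + ξ_{k,r}` with a fresh minibatch and `ξ_{k,r} ∼ N(0, σ₃² C_{3,k,r}² I)`. -/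
noncomputable def localStep (A : Config d n Z) (σ₃ : ℝ) {m : ℕ} (Dp : Fin m → Z) (k r : ℕ) :
    Kernel (Memory d) (Memory d) :=
  assign ((minibatchLaw m A.b).prod (stdGaussian (Vec d))) (.v k r)
    (fun q => localMean A Dp k r q.1 q.2.1 + (σ₃ * localRadius A k r q.1) • q.2.2)
    (((measurable_localMean A Dp k r).comp
        (measurable_fst.prodMk (measurable_fst.comp measurable_snd))).add
      ((((measurable_localRadius A k r).comp measurable_fst).const_mul σ₃).smul
        (measurable_snd.comp measurable_snd)))

/-- The first `j` passes `k = 2, …, j + 1` of the local loop of round `r`. -/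
noncomputable def localLoop (A : Config d n Z) (σ₃ : ℝ) {m : ℕ} (Dp : Fin m → Z) (r : ℕ) :
    ℕ → Kernel (Memory d) (Memory d)
  | 0 => Kernel.id
  | j + 1 => descentStep A (j + 2) r ∘ₖ localStep A σ₃ Dp (j + 2) r ∘ₖ localLoop A σ₃ Dp r j

/-- `x_r := x_{K,r-1}`. -/
noncomputable def returnStep (A : Config d n Z) (r : ℕ) : Kernel (Memory d) (Memory d) :=
  assign (Measure.dirac ()) (.x 0 r) (fun q => q.1 (.x A.K (r - 1))) (by fun_prop)

/-- The uniform distribution on `{1, …, K}`. -/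
noncomputable def indexLaw (K : ℕ) : Measure ℕ := uniformOn (Set.Icc 1 K)

instance (K : ℕ) : IsFiniteMeasure (indexLaw K) := by
  unfold indexLaw; infer_instance

/-- `x_r^out := x_{k,r-1}` with a fresh `k` that is uniform on `{1, …, K}`. -/
noncomputable def outStep (A : Config d n Z) (r : ℕ) : Kernel (Memory d) (Memory d) :=
  assign (indexLaw A.K) (.out r) (fun q => q.1 (.x q.2 (r - 1)))
    (measurable_from_prod_countable_left fun k => measurable_pi_apply (Slot.x k (r - 1)))

/-- Round `r` of DIFF2 with the BVR-L-SGD routine. -/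
noncomputable def round [NeZero P] (A : Config d n Z) (σ₁ σ₂ σ₃ : ℝ) (D : ∀ p, Fin (n p) → Z)
    (r : ℕ) : Kernel (Memory d) (Memory d) :=
  outStep A r ∘ₖ returnStep A r ∘ₖ localLoop A σ₃ (D (client P r)) r (A.K - 1)
    ∘ₖ descentStep A 1 r ∘ₖ serverStep A σ₁ σ₂ D r

/-- The law of the memory after `r` rounds; at the start `x_0 = x₀` and the other variables, which
are never read before they are assigned, are `0`. -/
noncomputable def lawAfter [NeZero P] (A : Config d n Z) (σ₁ σ₂ σ₃ : ℝ)
    (D : ∀ p, Fin (n p) → Z) : ℕ → Measure (Memory d)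
  | 0 => Measure.dirac (Function.update 0 (.x 0 0) A.x₀)
  | r + 1 => (lawAfter A σ₁ σ₂ σ₃ D r).bind (round A σ₁ σ₂ σ₃ D (r + 1))

/-- The mechanism `{x_r, x_r^out, ṽ_r}_{r ∈ [R]}`: the joint law of the released values. -/
noncomputable def mechanism [NeZero P] (A : Config d n Z) (σ₁ σ₂ σ₃ : ℝ)
    (D : ∀ p, Fin (n p) → Z) : Measure (Fin A.R → Vec d × Vec d × Vec d) :=
  (lawAfter A σ₁ σ₂ σ₃ D A.R).map
    fun s i => (s (.x 0 (i + 1)), s (.out (i + 1)), s (.v 1 (i + 1)))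

end Algorithm

/-! ### The mechanism is a genuine probability law -/

section Probability

variable {d P : ℕ} {n : Fin P → ℕ} {Z : Type*}

lemma isProbabilityMeasure_minibatchLaw {m b : ℕ} (h : b ≤ m) :
    IsProbabilityMeasure (minibatchLaw m b) := by
  obtain ⟨I, -, hI⟩ := Finset.exists_subset_card_eq (s := (Finset.univ : Finset (Fin m)))
    (by simpa using h)
  exact isProbabilityMeasure_uniformOn (Set.toFinite _) ⟨I, hI⟩

lemma isProbabilityMeasure_indexLaw {K : ℕ} (h : 1 ≤ K) : IsProbabilityMeasure (indexLaw K) :=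
  isProbabilityMeasure_uniformOn (Set.finite_Icc _ _) ⟨1, by simp [h]⟩

lemma isMarkovKernel_round [NeZero P] (A : Config d n Z) (σ₁ σ₂ σ₃ : ℝ)
    (D : ∀ p, Fin (n p) → Z) (r : ℕ) : IsMarkovKernel (round A σ₁ σ₂ σ₃ D r) := by
  have h1 := isProbabilityMeasure_indexLaw A.K_pos
  have h2 := isProbabilityMeasure_minibatchLaw (A.b_le (client P r))
  have h3 : ∀ j, IsMarkovKernel (localLoop A σ₃ (D (client P r)) r j) := by
    intro j
    induction j with
    | zero => unfold localLoop; infer_instance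
    | succ j ih => unfold localLoop descentStep localStep; infer_instance
  have h4 := h3 (A.K - 1)
  unfold round outStep returnStep descentStep serverStep
  infer_instance

theorem isProbabilityMeasure_mechanism [NeZero P] (A : Config d n Z) (σ₁ σ₂ σ₃ : ℝ)
    (D : ∀ p, Fin (n p) → Z) : IsProbabilityMeasure (mechanism A σ₁ σ₂ σ₃ D) := by
  have h : ∀ r, IsProbabilityMeasure (lawAfter A σ₁ σ₂ σ₃ D r) := by
    intro r
    induction r with
    | zero => unfold lawAfter; infer_instance
    | succ r ih =>
      have := isMarkovKernel_round A σ₁ σ₂ σ₃ D (r + 1)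
      unfold lawAfter
      infer_instance
  have := h A.R
  exact Measure.isProbabilityMeasure_map (by fun_prop)

end Probability

end DIFF2

/-! Privacy is tracked through Rényi divergence of a fixed integer order α and converted to
approximate differential privacy once, at the end. The divergence bound is kept in dual form: it
bounds the L^α(ν) norm of dμ/dν by testing against functions g. Post-processing is then a pullback
of g, adaptive composition (`RenyiLE.bind`) needs no densities of the kernels, and testing with an
indicator gives the conversion (`RenyiLE.measure_le`).

The program is a composition of kernels on the memory, and steps that read no data cost 0. By
clipping, a server step is a Gaussian mechanism of sensitivity 2/(n_p P σ) in units of its noise. A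
local step on the affected dataset is a subsampled Gaussian mechanism of relative sensitivity Δ =
2/(b σ₃); local steps of other clients have the same law under both collections of data. The total
cost then follows by counting restarts, other rounds, and visits to client p.

The heart is amplification by subsampling (`RenyiLE.mixture`). The two mixture densities satisfy p =
q + γy, where y is a mixture of differences of Gaussian densities. In the binomial expansion of p^α
/ q^(α-1), the term q integrates to 1 and the term αγy to 0. In the terms with y^j / q^(j-1), j ≥ 2,
joint convexity of |y|^j / z^(j-1) pulls the mixture out and leaves integrals of three Gaussians
with close means (`integral_ternary_le`). The means are close because of the coupling in
`sum_powersetCard_exchange`: a minibatch that misses the changed record arises from one that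
contains it by exchanging a single index.

For a prescribed ε, half of the budget pays for the conversion; the other half is split in the
proportions 1/u₁, 1/u₂ and 1 - 1/u₁ - 1/u₂ among the two server noises and the local noise. The
rates rest on two facts: αε is of order log(1/δ) (`order_bounds`), and under the bound on b the
subsampled level is at most 24 γ² α / (b² σ₃²) (`epsPrime_le`), where γ = b/n_min makes b cancel. -/

namespace DIFF2

open scoped ENNReal RealInnerProductSpace

/-! ### Rényi divergence bounds in dual form -/

/-- `RenyiLE α ε μ ν`: the Rényi divergence of order `α` of `μ` from `ν` is at most `ε`, stated
through the dual norm: `∫ g dμ ≤ e^{(α-1)ε/α} ‖g‖_{L^q(ν)}` with `1/α + 1/q = 1`. -/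
def RenyiLE {X : Type*} [MeasurableSpace X] (α ε : ℝ) (μ ν : Measure X) : Prop :=
  ∀ g : X → ℝ≥0∞, Measurable g →
    ∫⁻ x, g x ∂μ ≤ ENNReal.ofReal (Real.exp ((α - 1) / α * ε))
      * (∫⁻ x, g x ^ α.conjExponent ∂ν) ^ (1 / α.conjExponent)

namespace RenyiLE

variable {X Y : Type*} [MeasurableSpace X] [MeasurableSpace Y] {α ε ε' : ℝ} {μ ν : Measure X}

lemma mono (hα : 1 < α) (h : RenyiLE α ε μ ν) (hε : ε ≤ ε') : RenyiLE α ε' μ ν := by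
  intro g hg
  refine (h g hg).trans ?_
  have : 0 ≤ (α - 1) / α := div_nonneg (by linarith) (by linarith)
  gcongr

/-- Post-processing: a test function on the image pulls back to one on the source, with the same
integrals. -/
lemma map (h : RenyiLE α ε μ ν) {f : X → Y} (hf : Measurable f) :
    RenyiLE α ε (μ.map f) (ν.map f) := by
  intro g hg
  rw [lintegral_map hg hf, lintegral_map (by fun_prop) hf]
  exact h _ (hg.comp hf)

lemma refl (hα : 1 < α) (μ : Measure X) [IsProbabilityMeasure μ] : RenyiLE α 0 μ μ := by
  intro g hg
  have h := ENNReal.lintegral_mul_le_Lp_mul_Lq μ (Real.HolderConjugate.conjExponent hα)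
    (aemeasurable_const (b := (1 : ℝ≥0∞))) hg.aemeasurable
  simpa using h

/-- Adaptive composition. The kernel bound is applied inside, and the outer bound is applied to the
test function x ↦ ‖g‖ in L^q(η x). Its q-th power integrates over ν to the q-th moment of g under
the composed law, so the two exponents add. -/
lemma bind (hα : 1 < α) (h : RenyiLE α ε μ ν) {κ η : Kernel X Y}
    (hκ : ∀ x, RenyiLE α ε' (κ x) (η x)) : RenyiLE α (ε + ε') (μ.bind κ) (ν.bind η) := by
  intro g hg
  have hq : 0 < α.conjExponent := (Real.HolderConjugate.conjExponent hα).symm.pos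
  rw [Measure.lintegral_bind κ.aemeasurable hg.aemeasurable,
    Measure.lintegral_bind η.aemeasurable (by fun_prop)]
  have hm : Measurable fun x => ∫⁻ y, g y ^ α.conjExponent ∂(η x) :=
    Measurable.lintegral_kernel (by fun_prop)
  calc ∫⁻ x, ∫⁻ y, g y ∂(κ x) ∂μ
      ≤ ∫⁻ x, ENNReal.ofReal (Real.exp ((α - 1) / α * ε'))
        * (∫⁻ y, g y ^ α.conjExponent ∂(η x)) ^ (1 / α.conjExponent) ∂μ :=
        lintegral_mono fun x => hκ x g hg
    _ = ENNReal.ofReal (Real.exp ((α - 1) / α * ε'))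
        * ∫⁻ x, (∫⁻ y, g y ^ α.conjExponent ∂(η x)) ^ (1 / α.conjExponent) ∂μ :=
        lintegral_const_mul _ (by fun_prop)
    _ ≤ ENNReal.ofReal (Real.exp ((α - 1) / α * ε'))
        * (ENNReal.ofReal (Real.exp ((α - 1) / α * ε))
          * (∫⁻ x, ((∫⁻ y, g y ^ α.conjExponent ∂(η x)) ^ (1 / α.conjExponent))
            ^ α.conjExponent ∂ν) ^ (1 / α.conjExponent)) := by
        gcongr
        exact h _ (by fun_prop)
    _ = _ := by
        rw [← mul_assoc, ← ENNReal.ofReal_mul (Real.exp_nonneg _), ← Real.exp_add]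
        congr 2
        · congr 2; ring
        · simp_rw [← ENNReal.rpow_mul, one_div_mul_cancel hq.ne', ENNReal.rpow_one]

lemma comp (hα : 1 < α) {W : Type*} [MeasurableSpace W] {κ η : Kernel W X} {κ' η' : Kernel X Y}
    (h : ∀ w, RenyiLE α ε (κ w) (η w)) (h' : ∀ x, RenyiLE α ε' (κ' x) (η' x)) (w : W) :
    RenyiLE α (ε + ε') ((κ' ∘ₖ κ) w) ((η' ∘ₖ η) w) := by
  rw [Kernel.comp_apply, Kernel.comp_apply]
  exact (h w).bind hα h'

/-- A Rényi bound from densities `p`, `q` with respect to a common reference measure. -/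
lemma of_density (hα : 1 < α) {ρ : Measure X} {p q : X → ℝ} (hp : Measurable p)
    (hq : Measurable q) (hq0 : ∀ x, 0 < q x)
    (hμ : ∀ g : X → ℝ≥0∞, Measurable g → ∫⁻ x, g x ∂μ = ∫⁻ x, ENNReal.ofReal (p x) * g x ∂ρ)
    (hν : ∀ g : X → ℝ≥0∞, Measurable g → ∫⁻ x, g x ∂ν = ∫⁻ x, ENNReal.ofReal (q x) * g x ∂ρ)
    (h : ∫⁻ x, ENNReal.ofReal (p x) ^ α * ENNReal.ofReal (q x) ^ (1 - α) ∂ρ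
      ≤ ENNReal.ofReal (Real.exp ((α - 1) * ε))) :
    RenyiLE α ε μ ν := by
  intro g hg
  have hc := Real.HolderConjugate.conjExponent hα
  have hc0 : α.conjExponent ≠ 0 := hc.symm.pos.ne'
  have hα0 : α ≠ 0 := by linarith
  have hα1 : α - 1 ≠ 0 := by linarith
  have hq1 : ∀ x, ENNReal.ofReal (q x) ≠ 0 := fun x => by simpa using hq0 x
  rw [hμ g hg, hν _ (by fun_prop)]
  -- Hölder for the splitting p g = (p q^(-1/β)) (q^(1/β) g), β the conjugate exponent: the first
  -- factor gives the α-moment in `h`, the second the L^β(ν) norm of g.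
  have key := ENNReal.lintegral_mul_le_Lp_mul_Lq ρ hc
    (f := fun x => ENNReal.ofReal (p x) * ENNReal.ofReal (q x) ^ (-(1 / α.conjExponent)))
    (g := fun x => ENNReal.ofReal (q x) ^ (1 / α.conjExponent) * g x)
    (by fun_prop) (by fun_prop)
  have e1 : ∀ x, ((fun x => ENNReal.ofReal (p x) * ENNReal.ofReal (q x) ^ (-(1 / α.conjExponent)))
      * fun x => ENNReal.ofReal (q x) ^ (1 / α.conjExponent) * g x) x
      = ENNReal.ofReal (p x) * g x := by
    intro x
    simp only [Pi.mul_apply]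
    rw [mul_assoc, ← mul_assoc (_ ^ _) (_ ^ _), ← ENNReal.rpow_add _ _ (hq1 x) ENNReal.ofReal_ne_top]
    simp
  have e2 : ∀ x, (ENNReal.ofReal (p x) * ENNReal.ofReal (q x) ^ (-(1 / α.conjExponent))) ^ α
      = ENNReal.ofReal (p x) ^ α * ENNReal.ofReal (q x) ^ (1 - α) := by
    intro x
    rw [ENNReal.mul_rpow_of_nonneg _ _ (by linarith), ← ENNReal.rpow_mul]
    congr 2
    rw [Real.conjExponent]
    field_simp
    ring
  have e3 : ∀ x, (ENNReal.ofReal (q x) ^ (1 / α.conjExponent) * g x) ^ α.conjExponent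
      = ENNReal.ofReal (q x) * g x ^ α.conjExponent := by
    intro x
    rw [ENNReal.mul_rpow_of_nonneg _ _ hc.symm.nonneg, ← ENNReal.rpow_mul, one_div_mul_cancel hc0,
      ENNReal.rpow_one]
  simp_rw [e1, e2, e3] at key
  refine key.trans ?_
  gcongr
  calc _ ≤ (ENNReal.ofReal (Real.exp ((α - 1) * ε))) ^ (1 / α) := by gcongr
    _ = _ := by
      rw [ENNReal.ofReal_rpow_of_pos (Real.exp_pos _), ← Real.exp_mul]
      congr 2
      field_simp

/-- Conversion of a Rényi bound to approximate differential privacy. -/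
lemma measure_le (hα : 1 < α) {δ : ℝ} (hδ : 0 < δ) [IsFiniteMeasure ν] (h : RenyiLE α ε μ ν)
    {S : Set X} (hS : MeasurableSet S) :
    μ S ≤ ENNReal.ofReal (Real.exp (ε + Real.log (1 / δ) / (α - 1))) * ν S + ENNReal.ofReal δ := by
  have hc := Real.HolderConjugate.conjExponent hα
  have hα1 : 0 < α - 1 := by linarith
  have hα0 : 0 < α := by linarith
  have h1 := h (S.indicator 1) (measurable_one.indicator hS)
  have e : ∀ x, (S.indicator 1 x : ℝ≥0∞) ^ α.conjExponent = S.indicator 1 x := by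
    intro x
    by_cases hx : x ∈ S <;> simp [hx, hc.symm.pos]
  simp_rw [e, lintegral_indicator_one hS] at h1
  refine h1.trans ?_
  have hν : ν S = ENNReal.ofReal (ν S).toReal := by simp
  set t := (ν S).toReal with ht
  have ht0 : 0 ≤ t := ENNReal.toReal_nonneg
  rw [hν, ENNReal.ofReal_rpow_of_nonneg ht0 (by have := hc.symm.pos; positivity),
    ← ENNReal.ofReal_mul (Real.exp_nonneg _), ← ENNReal.ofReal_mul (Real.exp_nonneg _),
    ← ENNReal.ofReal_add (by positivity) hδ.le]
  apply ENNReal.ofReal_le_ofReal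
  have e1 : 1 / α.conjExponent = (α - 1) / α := by
    rw [Real.conjExponent]; field_simp
  set s := Real.exp ε * t with hs
  have hs0 : 0 ≤ s := by positivity
  have e2 : Real.exp ((α - 1) / α * ε) * t ^ (1 / α.conjExponent) = s ^ ((α - 1) / α) := by
    rw [hs, Real.mul_rpow (Real.exp_nonneg _) ht0, ← Real.exp_mul, e1, mul_comm ε]
  have e3 : Real.exp (ε + Real.log (1 / δ) / (α - 1)) * t = s * δ ^ (-(1 / (α - 1))) := by
    rw [Real.exp_add, hs, Real.rpow_def_of_pos hδ, one_div, Real.log_inv]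
    rw [show -Real.log δ / (α - 1) = Real.log δ * -(1 / (α - 1)) by ring]
    ring
  rw [e2, e3]
  -- With s = e^ε ν(S), the indicator of S gives μ(S) ≤ s^((α-1)/α). Below the threshold this is at
  -- most δ. Above it, the surplus factor s^(-1/α) is at most δ^(-1/(α-1)) = exp(log(1/δ)/(α-1)).
  rcases le_or_gt s (δ ^ (α / (α - 1))) with hle | hgt
  · have : s ^ ((α - 1) / α) ≤ δ := by
      calc s ^ ((α - 1) / α) ≤ (δ ^ (α / (α - 1))) ^ ((α - 1) / α) := by
            gcongr
        _ = δ := by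
          rw [← Real.rpow_mul hδ.le, show α / (α - 1) * ((α - 1) / α) = 1 by field_simp,
            Real.rpow_one]
    have : 0 ≤ s * δ ^ (-(1 / (α - 1))) := by positivity
    linarith
  · have hs1 : 0 < s := (Real.rpow_pos_of_pos hδ _).trans hgt
    have : s ^ ((α - 1) / α) ≤ s * δ ^ (-(1 / (α - 1))) := by
      rw [show (α - 1) / α = 1 + -(1 / α) by field_simp; ring, Real.rpow_add hs1, Real.rpow_one]
      gcongr
      calc s ^ (-(1 / α)) ≤ (δ ^ (α / (α - 1))) ^ (-(1 / α)) :=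
            Real.rpow_le_rpow_of_nonpos (Real.rpow_pos_of_pos hδ _) hgt.le
              (neg_nonpos.mpr (by positivity))
        _ = δ ^ (-(1 / (α - 1))) := by
          rw [← Real.rpow_mul hδ.le]
          congr 1
          field_simp
    linarith

end RenyiLE

/-! ### Translates of the standard Gaussian -/

section Gaussian

variable {d : ℕ}

/-- The density of `N(a, I)` with respect to `N(0, I)`. -/
noncomputable def shiftDensity (a x : Vec d) : ℝ := Real.exp (⟪a, x⟫ - ‖a‖ ^ 2 / 2)

lemma shiftDensity_pos (a x : Vec d) : 0 < shiftDensity a x := Real.exp_pos _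

@[fun_prop]
lemma measurable_shiftDensity (a : Vec d) : Measurable (shiftDensity a) := by
  unfold shiftDensity
  fun_prop

lemma exp_inner_toLp (a : Vec d) (y : Fin d → ℝ) :
    Real.exp ⟪a, WithLp.toLp 2 y⟫ = ∏ i, Real.exp (a i * y i) := by
  rw [← Real.exp_sum]
  simp [PiLp.inner_apply, mul_comm]

lemma integrable_exp_inner (a : Vec d) :
    Integrable (fun x => Real.exp ⟪a, x⟫) (stdGaussian (Vec d)) := by
  rw [← map_pi_eq_stdGaussian, integrable_map_measure (by fun_prop) (by fun_prop)]
  simp only [Function.comp_def, exp_inner_toLp]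
  exact Integrable.fintype_prod fun i => integrable_exp_mul_gaussianReal (a i)

lemma integrable_shiftDensity (a : Vec d) :
    Integrable (shiftDensity a) (stdGaussian (Vec d)) := by
  unfold shiftDensity
  simp_rw [Real.exp_sub]
  exact (integrable_exp_inner a).div_const _

/-- The coordinates are independent, so this is a product of one-dimensional complex moment
generating functions at a_i + i t_i. -/
lemma integral_cexp_inner (a t : Vec d) :
    ∫ x, Complex.exp (⟪a, x⟫ + ⟪x, t⟫ * Complex.I) ∂(stdGaussian (Vec d))
      = Complex.exp (∑ i, ((a i : ℂ) + t i * Complex.I) ^ 2 / 2) := by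
  rw [← map_pi_eq_stdGaussian, integral_map (by fun_prop)
    (Measurable.aestronglyMeasurable (by fun_prop)), Complex.exp_sum]
  have e : ∀ y : Fin d → ℝ, Complex.exp (⟪a, WithLp.toLp 2 y⟫ + ⟪WithLp.toLp 2 y, t⟫ * Complex.I)
      = ∏ i, Complex.exp (((a i : ℂ) + t i * Complex.I) * y i) := by
    intro y
    rw [← Complex.exp_sum]
    congr 1
    simp only [PiLp.inner_apply, RCLike.inner_apply, conj_trivial, Complex.ofReal_sum,
      Finset.sum_mul, ← Finset.sum_add_distrib]
    refine Finset.sum_congr rfl fun i _ => ?_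
    push_cast
    ring
  simp_rw [e]
  rw [integral_fintype_prod_eq_prod
    (f := fun i (y : ℝ) => Complex.exp (((a i : ℂ) + t i * Complex.I) * y))]
  refine Finset.prod_congr rfl fun i _ => ?_
  have := complexMGF_id_gaussianReal (μ := 0) (v := 1) ((a i : ℂ) + t i * Complex.I)
  simpa [complexMGF] using this

/-- The Cameron–Martin formula: both sides are finite measures, and their characteristic functions
agree by completing the square. -/
lemma map_add_stdGaussian (a : Vec d) :
    (stdGaussian (Vec d)).map (· + a)
      = (stdGaussian (Vec d)).withDensity fun x => ENNReal.ofReal (shiftDensity a x) := by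
  have := isFiniteMeasure_withDensity_ofReal (integrable_shiftDensity a).2
  have : IsFiniteMeasure ((stdGaussian (Vec d)).map (· + a)) := inferInstance
  apply Measure.ext_of_charFun
  ext t
  rw [charFun_map_add_const, charFun_stdGaussian, charFun_apply,
    integral_withDensity_eq_integral_toReal_smul (by fun_prop) (by simp)]
  have e : ∀ x : Vec d, (ENNReal.ofReal (shiftDensity a x)).toReal
      • Complex.exp (⟪x, t⟫ * Complex.I)
      = Complex.exp (-(‖a‖ ^ 2 / 2 : ℝ)) * Complex.exp (⟪a, x⟫ + ⟪x, t⟫ * Complex.I) := by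
    intro x
    rw [ENNReal.toReal_ofReal (shiftDensity_pos a x).le, shiftDensity, Complex.real_smul,
      Complex.ofReal_exp, ← Complex.exp_add, ← Complex.exp_add]
    push_cast
    ring_nf
  simp_rw [e]
  rw [integral_const_mul, integral_cexp_inner, ← Complex.exp_add, ← Complex.exp_add]
  congr 1
  have h1 : ‖a‖ ^ 2 = ∑ i, a i ^ 2 := EuclideanSpace.real_norm_sq_eq a
  have h2 : ‖t‖ ^ 2 = ∑ i, t i ^ 2 := EuclideanSpace.real_norm_sq_eq t
  have h3 : ⟪a, t⟫ = ∑ i, a i * t i := by simp [PiLp.inner_apply, mul_comm]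
  rw [← Complex.ofReal_pow, h1, h2, h3]
  push_cast
  simp only [Finset.sum_div, Finset.sum_mul, ← Finset.sum_neg_distrib, ← Finset.sum_add_distrib]
  refine Finset.sum_congr rfl fun i _ => ?_
  ring_nf
  simp
  ring

lemma lintegral_add_stdGaussian (a : Vec d) {g : Vec d → ℝ≥0∞} (hg : Measurable g) :
    ∫⁻ x, g (x + a) ∂(stdGaussian (Vec d))
      = ∫⁻ x, ENNReal.ofReal (shiftDensity a x) * g x ∂(stdGaussian (Vec d)) := by
  rw [← lintegral_map hg (measurable_add_const a), map_add_stdGaussian,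
    lintegral_withDensity_eq_lintegral_mul _ (by fun_prop) hg]
  rfl

lemma integral_shiftDensity (a : Vec d) : ∫ x, shiftDensity a x ∂(stdGaussian (Vec d)) = 1 := by
  have h := lintegral_add_stdGaussian a (g := 1) measurable_one
  rw [integral_eq_lintegral_of_nonneg_ae (.of_forall fun x => (shiftDensity_pos a x).le)
    (by fun_prop)]
  simp only [Pi.one_apply, lintegral_const, measure_univ, mul_one] at h
  rw [← h, ENNReal.toReal_one]

/-- Completing the square: the quotient is again a Gaussian density, with mean (j+1)a - jb, up to a
constant. As densities integrate to 1, that constant is the Rényi moment of order j+1. -/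
lemma shiftDensity_pow_div (a b x : Vec d) (j : ℕ) :
    shiftDensity a x ^ (j + 1) / shiftDensity b x ^ j
      = Real.exp ((j + 1 : ℝ) * j / 2 * ‖a - b‖ ^ 2)
        * shiftDensity (((j : ℝ) + 1) • a - (j : ℝ) • b) x := by
  unfold shiftDensity
  rw [← Real.exp_nat_mul, ← Real.exp_nat_mul, ← Real.exp_sub, ← Real.exp_add]
  congr 1
  simp only [@norm_sub_sq_real (Vec d), inner_sub_left, norm_smul, real_inner_smul_left, real_inner_smul_right,
    mul_pow, Real.norm_eq_abs, sq_abs]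
  push_cast
  ring

lemma integrable_shiftDensity_pow_div (a b : Vec d) (j : ℕ) :
    Integrable (fun x => shiftDensity a x ^ (j + 1) / shiftDensity b x ^ j)
      (stdGaussian (Vec d)) := by
  simp_rw [shiftDensity_pow_div]
  exact (integrable_shiftDensity _).const_mul _

lemma integral_shiftDensity_pow_div (a b : Vec d) (j : ℕ) :
    ∫ x, shiftDensity a x ^ (j + 1) / shiftDensity b x ^ j ∂(stdGaussian (Vec d))
      = Real.exp ((j + 1 : ℝ) * j / 2 * ‖a - b‖ ^ 2) := by
  simp_rw [shiftDensity_pow_div]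
  rw [integral_const_mul, integral_shiftDensity, mul_one]

/-- A Rényi bound of integer order between two laws which are given by densities with respect to
the standard Gaussian, from an integrable bound of the integrand. -/
lemma RenyiLE.of_gaussian_density {X : Type*} [MeasurableSpace X] {μ ν : Measure X}
    {α : ℕ} (hα : 2 ≤ α) {ε : ℝ} {f : Vec d → X} (hf : Measurable f)
    {p q G : Vec d → ℝ} (hp : Measurable p) (hq : Measurable q) (hp0 : ∀ x, 0 ≤ p x)
    (hq0 : ∀ x, 0 < q x)
    (hμ : ∀ g : X → ℝ≥0∞, Measurable g →
      ∫⁻ x, g x ∂μ = ∫⁻ x, ENNReal.ofReal (p x) * g (f x) ∂(stdGaussian (Vec d)))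
    (hν : ∀ g : X → ℝ≥0∞, Measurable g →
      ∫⁻ x, g x ∂ν = ∫⁻ x, ENNReal.ofReal (q x) * g (f x) ∂(stdGaussian (Vec d)))
    (hG : Integrable G (stdGaussian (Vec d))) (hpG : ∀ x, p x ^ α / q x ^ (α - 1) ≤ G x)
    (h : ∫ x, G x ∂(stdGaussian (Vec d)) ≤ Real.exp (((α : ℝ) - 1) * ε)) :
    RenyiLE α ε μ ν := by
  have hα1 : (1 : ℝ) < α := by exact_mod_cast hα
  have hmap : ∀ (μ : Measure X) (p : Vec d → ℝ), Measurable p → (∀ g : X → ℝ≥0∞, Measurable g →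
      ∫⁻ x, g x ∂μ = ∫⁻ x, ENNReal.ofReal (p x) * g (f x) ∂(stdGaussian (Vec d))) →
      μ = ((stdGaussian (Vec d)).withDensity fun x => ENNReal.ofReal (p x)).map f := by
    intro μ p hp h
    refine Measure.ext_of_lintegral _ fun g hg => ?_
    rw [h g hg, lintegral_map hg hf]
    exact (lintegral_withDensity_eq_lintegral_mul _ hp.ennreal_ofReal (hg.comp hf)).symm
  -- Both laws are images under the same `f`, so by post-processing it is enough to compare the two
  -- densities on `Vec d`.
  rw [hmap μ p hp hμ, hmap ν q hq hν]
  refine RenyiLE.map (RenyiLE.of_density hα1 hp hq hq0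
    (fun g hg => lintegral_withDensity_eq_lintegral_mul _ (by fun_prop) hg)
    (fun g hg => lintegral_withDensity_eq_lintegral_mul _ (by fun_prop) hg) ?_) hf
  have e : ∀ x, ENNReal.ofReal (p x) ^ (α : ℝ) * ENNReal.ofReal (q x) ^ (1 - (α : ℝ))
      = ENNReal.ofReal (p x ^ α / q x ^ (α - 1)) := by
    intro x
    rw [ENNReal.ofReal_rpow_of_nonneg (hp0 x) (by positivity), ENNReal.ofReal_rpow_of_pos (hq0 x),
      ← ENNReal.ofReal_mul (by have := hp0 x; positivity), Real.rpow_natCast,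
      show (1 - (α : ℝ)) = -((α - 1 : ℕ) : ℝ) by push_cast [Nat.cast_sub (by omega : 1 ≤ α)]; ring,
      Real.rpow_neg (hq0 x).le, Real.rpow_natCast, div_eq_mul_inv]
  simp_rw [e]
  have hG0 : ∀ x, 0 ≤ G x := fun x =>
    (div_nonneg (pow_nonneg (hp0 x) _) (pow_nonneg (hq0 x).le _)).trans (hpG x)
  calc _ ≤ ∫⁻ x, ENNReal.ofReal (G x) ∂(stdGaussian (Vec d)) :=
        lintegral_mono fun x => ENNReal.ofReal_le_ofReal (hpG x)
    _ = ENNReal.ofReal (∫ x, G x ∂(stdGaussian (Vec d))) :=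
        (ofReal_integral_eq_lintegral_ofReal hG (.of_forall hG0)).symm
    _ ≤ _ := ENNReal.ofReal_le_ofReal h

/-- The Gaussian mechanism. -/
lemma RenyiLE.gaussian {X : Type*} [MeasurableSpace X] {α : ℕ} (hα : 2 ≤ α) {c Δ : ℝ}
    {a b : Vec d} (h : ‖a - b‖ ≤ Δ * c) (hc : 0 ≤ c) {f : Vec d → X} (hf : Measurable f) :
    RenyiLE α (α * Δ ^ 2 / 2) ((stdGaussian (Vec d)).map fun w => f (a + c • w))
      ((stdGaussian (Vec d)).map fun w => f (b + c • w)) := by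
  have hα1 : (1 : ℝ) < α := by exact_mod_cast hα
  have hf' : Measurable fun v : Vec d => f (c • v) := by fun_prop
  -- The noise degenerates when two successive iterates coincide and the clipping radius is 0; the
  -- sensitivity then vanishes too, and the laws are equal.
  rcases hc.eq_or_lt with rfl | hc
  · have hab : a = b := by
      rw [mul_zero] at h
      exact sub_eq_zero.1 (norm_le_zero_iff.1 h)
    subst hab
    have : IsProbabilityMeasure ((stdGaussian (Vec d)).map fun w => f (a + (0 : ℝ) • w)) :=
      Measure.isProbabilityMeasure_map (by fun_prop)
    exact (RenyiLE.refl hα1 _).mono hα1 (by positivity)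
  · have hsub : ∀ (a : Vec d) (g : X → ℝ≥0∞), Measurable g →
        ∫⁻ x, g x ∂((stdGaussian (Vec d)).map fun w => f (a + c • w))
          = ∫⁻ x, ENNReal.ofReal (shiftDensity (c⁻¹ • a) x) * g (f (c • x))
            ∂(stdGaussian (Vec d)) := by
      intro a g hg
      rw [lintegral_map hg (by fun_prop)]
      refine Eq.trans (lintegral_congr fun x => ?_)
        (lintegral_add_stdGaussian (c⁻¹ • a) (hg.comp hf'))
      simp only [smul_add, smul_inv_smul₀ hc.ne', add_comm]
    obtain ⟨m, rfl⟩ : ∃ m, α = m + 1 := ⟨α - 1, by omega⟩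
    refine RenyiLE.of_gaussian_density hα hf' (measurable_shiftDensity _)
      (measurable_shiftDensity _) (fun x => (shiftDensity_pos _ x).le) (shiftDensity_pos _)
      (hsub a) (hsub b) (integrable_shiftDensity_pow_div (c⁻¹ • a) (c⁻¹ • b) m)
      (fun x => le_rfl) ?_
    rw [integral_shiftDensity_pow_div]
    have hn : ‖c⁻¹ • a - c⁻¹ • b‖ ^ 2 ≤ Δ ^ 2 := by
      rw [← smul_sub, norm_smul, norm_inv, Real.norm_of_nonneg hc.le]
      have : c⁻¹ * ‖a - b‖ ≤ Δ := by
        rw [inv_mul_le_iff₀ hc, mul_comm]; exact h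
      gcongr
    apply Real.exp_le_exp.2
    push_cast
    calc ((m : ℝ) + 1) * m / 2 * ‖c⁻¹ • a - c⁻¹ • b‖ ^ 2 ≤ ((m : ℝ) + 1) * m / 2 * Δ ^ 2 := by
          gcongr
      _ = _ := by ring

end Gaussian

/-! ### Subsampling without replacement -/

/-- Radon's inequality with weights. -/
lemma abs_sum_pow_div_le {κ : Type*} (s : Finset κ) (w y z : κ → ℝ) (hw : ∀ k ∈ s, 0 ≤ w k)
    (hz : ∀ k ∈ s, 0 < z k) (hZ : 0 < ∑ k ∈ s, w k * z k) (j : ℕ) :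
    |∑ k ∈ s, w k * y k| ^ (j + 1) / (∑ k ∈ s, w k * z k) ^ j
      ≤ ∑ k ∈ s, w k * (|y k| ^ (j + 1) / z k ^ j) := by
  set Z := ∑ k ∈ s, w k * z k with hZdef
  -- Jensen for t ↦ t^(j+1) at the points |y k| / z k, with weights proportional to w k * z k.
  have h := Real.pow_arith_mean_le_arith_mean_pow s (fun k => w k * z k / Z) (fun k => |y k| / z k)
    (fun k hk => div_nonneg (mul_nonneg (hw k hk) (hz k hk).le) hZ.le)
    (by rw [← Finset.sum_div, ← hZdef, div_self hZ.ne'])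
    (fun k hk => div_nonneg (abs_nonneg _) (hz k hk).le) (j + 1)
  have e1 : ∑ k ∈ s, w k * z k / Z * (|y k| / z k) = (∑ k ∈ s, w k * |y k|) / Z := by
    rw [Finset.sum_div]
    refine Finset.sum_congr rfl fun k hk => ?_
    have := (hz k hk).ne'
    field_simp
  have e2 : ∑ k ∈ s, w k * z k / Z * (|y k| / z k) ^ (j + 1)
      = (∑ k ∈ s, w k * (|y k| ^ (j + 1) / z k ^ j)) / Z := by
    rw [Finset.sum_div]
    refine Finset.sum_congr rfl fun k hk => ?_
    have := (hz k hk).ne'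
    rw [div_pow, pow_succ (z k)]
    field_simp
  rw [e1, e2, div_pow, le_div_iff₀ hZ] at h
  refine le_trans ?_ h
  rw [pow_succ Z, div_mul_eq_mul_div, mul_div_mul_right _ _ hZ.ne']
  gcongr
  refine (Finset.abs_sum_le_sum_abs _ _).trans (Finset.sum_le_sum fun k hk => ?_)
  rw [abs_mul, abs_of_nonneg (hw k hk)]

lemma abs_sub_pow_le_add_pow {u v : ℝ} (hu : 0 ≤ u) (hv : 0 ≤ v) (j : ℕ) :
    |u - v| ^ j ≤ u ^ j + v ^ j := by
  have h1 : 0 ≤ u ^ j := pow_nonneg hu j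
  have h2 : 0 ≤ v ^ j := pow_nonneg hv j
  rcases le_total u v with h | h
  · have : |u - v| ^ j ≤ v ^ j :=
      pow_le_pow_left₀ (abs_nonneg _) (by rw [abs_le]; constructor <;> linarith) j
    linarith
  · have : |u - v| ^ j ≤ u ^ j :=
      pow_le_pow_left₀ (abs_nonneg _) (by rw [abs_le]; constructor <;> linarith) j
    linarith

/-- The bound on the ternary divergence of order `j` of the Gaussian mechanism of sensitivity `Δ`
and unit noise. -/
noncomputable def ternaryBound (Δ : ℝ) (j : ℕ) : ℝ :=
  if j = 2 then min (4 * (Real.exp (Δ ^ 2) - 1)) (Real.exp (Δ ^ 2) * 2)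
  else Real.exp ((j : ℝ) * ((j : ℝ) - 1) / 2 * Δ ^ 2) * 2

lemma ternaryBound_nonneg (Δ : ℝ) (j : ℕ) : 0 ≤ ternaryBound Δ j := by
  unfold ternaryBound
  have : 1 ≤ Real.exp (Δ ^ 2) := Real.one_le_exp (sq_nonneg _)
  split_ifs
  · exact le_min (by linarith) (by positivity)
  · positivity

section Ternary

variable {d : ℕ} {Δ : ℝ}

/-- The ternary divergence of order `j + 1` of three Gaussians with close means. -/
lemma integral_ternary_le {a a' c : Vec d} (h1 : ‖a - c‖ ≤ Δ) (h2 : ‖a' - c‖ ≤ Δ) (j : ℕ) :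
    Integrable (fun x => |shiftDensity a x - shiftDensity a' x| ^ (j + 1) / shiftDensity c x ^ j)
      (stdGaussian (Vec d)) ∧
    ∫ x, |shiftDensity a x - shiftDensity a' x| ^ (j + 1) / shiftDensity c x ^ j
      ∂(stdGaussian (Vec d)) ≤ ternaryBound Δ (j + 1) := by
  have hi := fun (a : Vec d) (j : ℕ) => integrable_shiftDensity_pow_div a c j
  have hv : ∀ (a : Vec d), ‖a - c‖ ≤ Δ → ∀ j : ℕ,
      ∫ x, shiftDensity a x ^ (j + 1) / shiftDensity c x ^ j ∂(stdGaussian (Vec d))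
        ≤ Real.exp ((j + 1 : ℝ) * j / 2 * Δ ^ 2) := by
    intro a h j
    rw [integral_shiftDensity_pow_div]
    gcongr
  have hle : ∀ x, |shiftDensity a x - shiftDensity a' x| ^ (j + 1) / shiftDensity c x ^ j
      ≤ shiftDensity a x ^ (j + 1) / shiftDensity c x ^ j
        + shiftDensity a' x ^ (j + 1) / shiftDensity c x ^ j := by
    intro x
    have := shiftDensity_pos c x
    rw [← add_div]
    gcongr
    exact abs_sub_pow_le_add_pow (shiftDensity_pos a x).le (shiftDensity_pos a' x).le _
  have hG := (hi a j).add (hi a' j)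
  have hF : Integrable (fun x => |shiftDensity a x - shiftDensity a' x| ^ (j + 1)
      / shiftDensity c x ^ j) (stdGaussian (Vec d)) := by
    refine hG.mono' (Measurable.aestronglyMeasurable (by fun_prop)) (.of_forall fun x => ?_)
    have := shiftDensity_pos c x
    rw [Real.norm_of_nonneg (by positivity)]
    exact hle x
  refine ⟨hF, ?_⟩
  have hgen : ∫ x, |shiftDensity a x - shiftDensity a' x| ^ (j + 1) / shiftDensity c x ^ j
      ∂(stdGaussian (Vec d)) ≤ Real.exp ((j + 1 : ℝ) * j / 2 * Δ ^ 2) * 2 := by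
    refine (integral_mono hF hG hle).trans ?_
    simp only [Pi.add_apply]
    rw [integral_add (hi a j) (hi a' j)]
    linarith [hv a h1 j, hv a' h2 j]
  unfold ternaryBound
  split_ifs with hj
  · obtain rfl : j = 1 := by omega
    norm_num at hgen
    refine le_min ?_ (by norm_num; exact hgen)
    -- For order 2 the crude bound does not vanish as Δ → 0. The integrand here is (p_a - p_c)² /
    -- p_c, a χ² integrand with integral at most e^(Δ²) - 1, and (u - v)² ≤ 2(u - z)² + 2(v - z)²
    -- reduces the ternary case to two of these.
    have hs : ∀ a : Vec d, Integrable (fun x => shiftDensity a x ^ 2 / shiftDensity c x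
        - 2 * shiftDensity a x + shiftDensity c x) (stdGaussian (Vec d)) := by
      intro a
      have := hi a 1
      norm_num at this
      exact (this.sub' ((integrable_shiftDensity a).const_mul 2)).fun_add (integrable_shiftDensity c)
    have hsv : ∀ a : Vec d, ‖a - c‖ ≤ Δ → ∫ x, (shiftDensity a x ^ 2 / shiftDensity c x
        - 2 * shiftDensity a x + shiftDensity c x) ∂(stdGaussian (Vec d))
          ≤ Real.exp (Δ ^ 2) - 1 := by
      intro a h
      have h1 := hi a 1
      have h2 := hv a h 1
      norm_num at h1 h2
      rw [integral_add (h1.sub' ((integrable_shiftDensity a).const_mul 2))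
        (integrable_shiftDensity c), integral_sub h1 ((integrable_shiftDensity a).const_mul 2),
        integral_const_mul, integral_shiftDensity, integral_shiftDensity]
      linarith
    have hmono := integral_mono hF (((hs a).const_mul 2).add ((hs a').const_mul 2)) fun x => ?_
    · simp only [Pi.add_apply] at hmono
      rw [integral_add ((hs a).const_mul 2) ((hs a').const_mul 2), integral_const_mul,
        integral_const_mul] at hmono
      linarith [hsv a h1, hsv a' h2]
    · have hc := shiftDensity_pos c x
      simp only [Pi.add_apply, sq_abs, Nat.reduceAdd, pow_one]
      generalize shiftDensity a x = u
      generalize shiftDensity a' x = v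
      generalize shiftDensity c x = z at hc
      rw [div_le_iff₀ hc]
      have e : (2 * (u ^ 2 / z - 2 * u + z) + 2 * (v ^ 2 / z - 2 * v + z)) * z
          = 2 * (u - z) ^ 2 + 2 * (v - z) ^ 2 := by
        field_simp
        ring
      rw [e]
      nlinarith [sq_nonneg (u + v - 2 * z)]
  · push_cast
    rw [add_sub_cancel_right]
    exact hgen

end Ternary

/-- Amplification by subsampling for a mixture of Gaussians: in the `k`-th component the data are
replaced by `a k`, `a' k` with probability `γ`, and are `c k` in both laws otherwise. -/
lemma RenyiLE.mixture {d : ℕ} {X : Type*} [MeasurableSpace X] {μ ν : Measure X}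
    {α : ℕ} (hα : 2 ≤ α) {Δ γ : ℝ} (hΔ : 0 ≤ Δ) (hγ0 : 0 ≤ γ) (hγ1 : γ ≤ 1)
    {κ : Type*} (s : Finset κ) (w : κ → ℝ) (hw : ∀ k ∈ s, 0 ≤ w k) (hw1 : ∑ k ∈ s, w k = 1)
    (a a' c : κ → Vec d) (h1 : ∀ k ∈ s, ‖a k - a' k‖ ≤ Δ) (h2 : ∀ k ∈ s, ‖a k - c k‖ ≤ Δ)
    (h3 : ∀ k ∈ s, ‖a' k - c k‖ ≤ Δ) {f : Vec d → X} (hf : Measurable f)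
    (hμ : ∀ g : X → ℝ≥0∞, Measurable g →
      ∫⁻ x, g x ∂μ = ∫⁻ x, ENNReal.ofReal (∑ k ∈ s, w k * (γ * shiftDensity (a k) x
        + (1 - γ) * shiftDensity (c k) x)) * g (f x) ∂(stdGaussian (Vec d)))
    (hν : ∀ g : X → ℝ≥0∞, Measurable g →
      ∫⁻ x, g x ∂ν = ∫⁻ x, ENNReal.ofReal (∑ k ∈ s, w k * (γ * shiftDensity (a' k) x
        + (1 - γ) * shiftDensity (c k) x)) * g (f x) ∂(stdGaussian (Vec d))) :
    RenyiLE α (1 / ((α : ℝ) - 1) * Real.log (1 + γ ^ 2 * (α.choose 2 : ℝ) * ternaryBound Δ 2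
      + ∑ j ∈ Finset.Icc 3 α, γ ^ j * (α.choose j : ℝ) * ternaryBound Δ j)) μ ν := by
  have hγ1' : 0 ≤ 1 - γ := by linarith
  have hα1 : (1 : ℝ) < α := by exact_mod_cast hα
  set q : κ → Vec d → ℝ := fun k x => γ * shiftDensity (a' k) x + (1 - γ) * shiftDensity (c k) x
    with hqdef
  have hqpos : ∀ k x, 0 < q k x := by
    intro k x
    have e1 := shiftDensity_pos (a' k) x
    have e2 := shiftDensity_pos (c k) x
    rcases hγ0.eq_or_lt with h | h
    · simp only [hqdef, ← h]; linarith
    · have := mul_pos h e1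
      have := mul_nonneg hγ1' e2.le
      simp only [hqdef]; linarith
  have hQpos : ∀ x, 0 < ∑ k ∈ s, w k * q k x := by
    intro x
    have hne : ∃ k ∈ s, 0 < w k := by
      by_contra! hcon
      have : ∑ k ∈ s, w k ≤ 0 := Finset.sum_nonpos hcon
      linarith
    obtain ⟨k, hk, hwk⟩ := hne
    exact Finset.sum_pos' (fun k hk => mul_nonneg (hw k hk) (hqpos k x).le)
      ⟨k, hk, mul_pos hwk (hqpos k x)⟩
  set y : κ → Vec d → ℝ := fun k x => shiftDensity (a k) x - shiftDensity (a' k) x with hydef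
  -- The majorant of the term of order j + 1 after convexity has been used twice: over the
  -- components k, and over the two parts of weights γ and 1 - γ inside `q k`.
  set F : ℕ → Vec d → ℝ := fun j x => ∑ k ∈ s, w k *
    (γ * (|y k x| ^ (j + 1) / shiftDensity (a' k) x ^ j)
      + (1 - γ) * (|y k x| ^ (j + 1) / shiftDensity (c k) x ^ j)) with hFdef
  have hΔ0 : ∀ k, ‖a' k - a' k‖ ≤ Δ := fun k => by simpa using hΔ
  have hFi : ∀ j, Integrable (F j) (stdGaussian (Vec d)) := fun j =>
    integrable_finsetSum _ fun k hk =>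
      (((integral_ternary_le (h1 k hk) (hΔ0 k) j).1.const_mul γ).fun_add
        ((integral_ternary_le (h2 k hk) (h3 k hk) j).1.const_mul (1 - γ))).const_mul (w k)
  have hFv : ∀ j, ∫ x, F j x ∂(stdGaussian (Vec d)) ≤ ternaryBound Δ (j + 1) := by
    intro j
    simp only [hFdef]
    rw [integral_finsetSum _ fun k hk =>
      (((integral_ternary_le (h1 k hk) (hΔ0 k) j).1.const_mul γ).fun_add
        ((integral_ternary_le (h2 k hk) (h3 k hk) j).1.const_mul (1 - γ))).const_mul (w k)]
    calc _ ≤ ∑ k ∈ s, w k * ternaryBound Δ (j + 1) := by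
          refine Finset.sum_le_sum fun k hk => ?_
          have i1 := integral_ternary_le (h1 k hk) (hΔ0 k) j
          have i2 := integral_ternary_le (h2 k hk) (h3 k hk) j
          rw [integral_const_mul, integral_add (i1.1.const_mul γ) (i2.1.const_mul (1 - γ)),
            integral_const_mul, integral_const_mul]
          refine mul_le_mul_of_nonneg_left ?_ (hw k hk)
          have e1 := mul_le_mul_of_nonneg_left i1.2 hγ0
          have e2 := mul_le_mul_of_nonneg_left i2.2 hγ1'
          linarith
      _ = ternaryBound Δ (j + 1) := by rw [← Finset.sum_mul, hw1, one_mul]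
  have hFle : ∀ j x, |∑ k ∈ s, w k * y k x| ^ (j + 1) / (∑ k ∈ s, w k * q k x) ^ j ≤ F j x := by
    intro j x
    refine (abs_sum_pow_div_le s w (y · x) (q · x) hw (fun k _ => hqpos k x) (hQpos x) j).trans ?_
    refine Finset.sum_le_sum fun k hk => mul_le_mul_of_nonneg_left ?_ (hw k hk)
    -- The second convexity step: `y k x` is written as its own average with weights γ and 1 - γ, to
    -- match the two-point mixture in the denominator.
    have h := abs_sum_pow_div_le Finset.univ (fun t : Bool => if t then γ else 1 - γ)
      (fun _ => y k x) (fun t => if t then shiftDensity (a' k) x else shiftDensity (c k) x)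
      (by intro t _; split_ifs <;> assumption)
      (by intro t _; split_ifs <;> exact shiftDensity_pos _ _)
      (by simpa using hqpos k x) j
    simp only [Fintype.sum_bool, if_true, Bool.false_eq_true, if_false, ← add_mul] at h
    simpa using h
  obtain ⟨m, rfl⟩ : ∃ m, α = m + 2 := ⟨α - 2, by omega⟩
  -- The binomial expansion of (q + γy)^α / q^(α-1), with every term of order at least 2 replaced by
  -- its majorant. The linear term is kept exactly, since it integrates to 0.
  set G : Vec d → ℝ := fun x => (∑ k ∈ s, w k * q k x)
    + ((m + 2 : ℕ) : ℝ) * γ * (∑ k ∈ s, w k * y k x)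
    + ∑ j ∈ Finset.range (m + 1), γ ^ (j + 2) * ((m + 2).choose (j + 2) : ℝ) * F (j + 1) x
    with hGdef
  have hqi : Integrable (fun x => ∑ k ∈ s, w k * q k x) (stdGaussian (Vec d)) :=
    integrable_finsetSum _ fun k _ => (((integrable_shiftDensity _).const_mul _).fun_add
      ((integrable_shiftDensity _).const_mul _)).const_mul _
  have hyi : Integrable (fun x => ∑ k ∈ s, w k * y k x) (stdGaussian (Vec d)) :=
    integrable_finsetSum _ fun k _ =>
      ((integrable_shiftDensity _).sub' (integrable_shiftDensity _)).const_mul _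
  have hqv : ∫ x, (∑ k ∈ s, w k * q k x) ∂(stdGaussian (Vec d)) = 1 := by
    rw [integral_finsetSum _ fun k _ => (((integrable_shiftDensity _).const_mul _).fun_add
      ((integrable_shiftDensity _).const_mul _)).const_mul _]
    refine Eq.trans (Finset.sum_congr rfl fun k _ => ?_) hw1
    rw [integral_const_mul, integral_add ((integrable_shiftDensity _).const_mul _)
      ((integrable_shiftDensity _).const_mul _), integral_const_mul, integral_const_mul,
      integral_shiftDensity, integral_shiftDensity]
    ring
  have hyv : ∫ x, (∑ k ∈ s, w k * y k x) ∂(stdGaussian (Vec d)) = 0 := by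
    rw [integral_finsetSum _ fun k _ =>
      ((integrable_shiftDensity _).sub' (integrable_shiftDensity _)).const_mul _]
    refine Finset.sum_eq_zero fun k _ => ?_
    rw [integral_const_mul, integral_sub (integrable_shiftDensity _) (integrable_shiftDensity _),
      integral_shiftDensity, integral_shiftDensity]
    ring
  have hSi : Integrable (fun x => ∑ j ∈ Finset.range (m + 1),
      γ ^ (j + 2) * ((m + 2).choose (j + 2) : ℝ) * F (j + 1) x) (stdGaussian (Vec d)) :=
    integrable_finsetSum _ fun j _ => (hFi _).const_mul _
  have hyi' := hyi.const_mul (((m + 2 : ℕ) : ℝ) * γ)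
  have hGi : Integrable G (stdGaussian (Vec d)) := (hqi.fun_add hyi').fun_add hSi
  set B := 1 + γ ^ 2 * ((m + 2).choose 2 : ℝ) * ternaryBound Δ 2
      + ∑ j ∈ Finset.Icc 3 (m + 2), γ ^ j * ((m + 2).choose j : ℝ) * ternaryBound Δ j with hB
  have hBeq : B = 1 + ∑ j ∈ Finset.range (m + 1),
      γ ^ (j + 2) * ((m + 2).choose (j + 2) : ℝ) * ternaryBound Δ (j + 2) := by
    rw [Finset.sum_range_succ', hB]
    have : Finset.Icc 3 (m + 2) = Finset.Ico 3 (m + 3) := by ext; simp; omega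
    rw [this, Finset.sum_Ico_eq_sum_range]
    simp only [zero_add, show m + 3 - 3 = m by omega, show ∀ k, 3 + k = k + 1 + 2 by intro; omega]
    ring
  have hB1 : 1 ≤ B := by
    rw [hBeq]
    have : 0 ≤ ∑ j ∈ Finset.range (m + 1),
      γ ^ (j + 2) * ((m + 2).choose (j + 2) : ℝ) * ternaryBound Δ (j + 2) :=
      Finset.sum_nonneg fun j _ => by have := ternaryBound_nonneg Δ (j + 2); positivity
    linarith
  refine RenyiLE.of_gaussian_density hα hf (by fun_prop) (by fun_prop)
    (fun x => Finset.sum_nonneg fun k hk => mul_nonneg (hw k hk) (add_nonneg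
      (mul_nonneg hγ0 (shiftDensity_pos _ _).le) (mul_nonneg hγ1' (shiftDensity_pos _ _).le)))
    hQpos hμ hν hGi ?_ ?_
  · intro x
    have hP : ∑ k ∈ s, w k * (γ * shiftDensity (a k) x + (1 - γ) * shiftDensity (c k) x)
        = γ * (∑ k ∈ s, w k * y k x) + ∑ k ∈ s, w k * q k x := by
      rw [Finset.mul_sum, ← Finset.sum_add_distrib]
      refine Finset.sum_congr rfl fun k _ => ?_
      simp only [hydef, hqdef]
      ring
    rw [hP]
    have hQ := hQpos x
    have hFx := fun j => hFle j x
    simp only [hGdef]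
    generalize ∑ k ∈ s, w k * q k x = Q at *
    generalize ∑ k ∈ s, w k * y k x = Y at *
    rw [div_le_iff₀ (by positivity), add_pow, Finset.sum_range_succ', Finset.sum_range_succ',
      add_mul, add_mul, Finset.sum_mul]
    have e0 : (γ * Y) ^ 0 * Q ^ (m + 2 - 0) * ((m + 2).choose 0 : ℝ) = Q * Q ^ (m + 2 - 1) := by
      rw [show m + 2 - 1 = m + 1 by omega, Nat.sub_zero, Nat.choose_zero_right]
      push_cast
      ring
    have e1 : (γ * Y) ^ (0 + 1) * Q ^ (m + 2 - (0 + 1)) * ((m + 2).choose (0 + 1) : ℝ)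
        = ((m + 2 : ℕ) : ℝ) * γ * Y * Q ^ (m + 2 - 1) := by
      rw [zero_add, Nat.choose_one_right]
      ring
    rw [e0, e1]
    have e2 : ∑ j ∈ Finset.range (m + 1), (γ * Y) ^ (j + 1 + 1) * Q ^ (m + 2 - (j + 1 + 1))
          * ((m + 2).choose (j + 1 + 1) : ℝ)
        ≤ ∑ j ∈ Finset.range (m + 1),
          γ ^ (j + 2) * ((m + 2).choose (j + 2) : ℝ) * F (j + 1) x * Q ^ (m + 2 - 1) := by
      refine Finset.sum_le_sum fun j hj => ?_
      have hj' : j ≤ m := Nat.lt_succ_iff.1 (Finset.mem_range.1 hj)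
      have hYle : Y ^ (j + 2) * Q ^ (m - j) ≤ F (j + 1) x * Q ^ (m + 1) := by
        calc Y ^ (j + 2) * Q ^ (m - j) ≤ |Y| ^ (j + 2) * Q ^ (m - j) := by
              refine mul_le_mul_of_nonneg_right ?_ (by positivity)
              exact (le_abs_self (Y ^ (j + 2))).trans (abs_pow Y _).le
          _ = |Y| ^ (j + 1 + 1) / Q ^ (j + 1) * Q ^ (m + 1) := by
              rw [show m + 1 = (m - j) + (j + 1) by omega, pow_add Q]
              field_simp
              ring
          _ ≤ _ := by gcongr; exact hFx (j + 1)
      rw [show m + 2 - 1 = m + 1 by omega, show m + 2 - (j + 1 + 1) = m - j by omega, mul_pow]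
      calc _ = γ ^ (j + 2) * ((m + 2).choose (j + 2) : ℝ) * (Y ^ (j + 2) * Q ^ (m - j)) := by ring
        _ ≤ γ ^ (j + 2) * ((m + 2).choose (j + 2) : ℝ) * (F (j + 1) x * Q ^ (m + 1)) := by gcongr
        _ = _ := by ring
    linarith
  · have hα0 : ((m + 2 : ℕ) : ℝ) - 1 ≠ 0 := by linarith
    rw [← mul_assoc, mul_one_div_cancel hα0, one_mul, Real.exp_log (by linarith)]
    simp only [hGdef]
    rw [integral_add (hqi.fun_add hyi') hSi, integral_add hqi hyi', integral_const_mul, hqv, hyv,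
      integral_finsetSum _ fun j _ => (hFi _).const_mul _, hBeq]
    simp_rw [integral_const_mul]
    have : ∑ j ∈ Finset.range (m + 1), γ ^ (j + 2) * ((m + 2).choose (j + 2) : ℝ)
        * ∫ x, F (j + 1) x ∂(stdGaussian (Vec d)) ≤ ∑ j ∈ Finset.range (m + 1),
          γ ^ (j + 2) * ((m + 2).choose (j + 2) : ℝ) * ternaryBound Δ (j + 2) :=
      Finset.sum_le_sum fun j _ => mul_le_mul_of_nonneg_left (hFv (j + 1)) (by positivity)
    linarith

/-- A sum over the `b`-subsets, split by whether they contain `i`; a subset `I ∌ i` is obtained by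
an exchange of `i` for `j` from `b` subsets that contain `i`. -/
lemma sum_powersetCard_exchange {m b : ℕ} (hb : 1 ≤ b) (hbm : b < m) (i : Fin m)
    (h : Finset (Fin m) → ℝ) :
    ∑ I ∈ Finset.powersetCard b Finset.univ, h I
      = ∑ k ∈ ((Finset.powersetCard b Finset.univ).filter (i ∈ ·)).sigma fun I => Iᶜ,
        (h k.1 / ((m : ℝ) - b) + h (insert k.2 (k.1.erase i)) / b) := by
  have hb0 : (b : ℝ) ≠ 0 := by positivity
  have hbm0 : (m : ℝ) - b ≠ 0 := by
    have : (b : ℝ) < m := by exact_mod_cast hbm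
    linarith
  rw [← Finset.sum_filter_add_sum_filter_not _ (i ∈ ·), Finset.sum_add_distrib]
  congr 1
  · rw [Finset.sum_sigma]
    refine Finset.sum_congr rfl fun I hI => ?_
    have hI' : I.card = b := (Finset.mem_powersetCard.1 (Finset.mem_filter.1 hI).1).2
    simp only [Finset.sum_const, Finset.card_compl, Fintype.card_fin, hI', nsmul_eq_mul]
    rw [Nat.cast_sub hbm.le]
    field_simp
  -- A subset I that misses i is counted b times, once for each j in I that can be exchanged back
  -- for i.
  · have e : ∑ I ∈ (Finset.powersetCard b Finset.univ).filter (i ∉ ·), h I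
        = ∑ k ∈ ((Finset.powersetCard b Finset.univ).filter (i ∉ ·)).sigma fun I => I,
          h k.1 / b := by
      rw [Finset.sum_sigma]
      refine Finset.sum_congr rfl fun I hI => ?_
      have hI' : I.card = b := (Finset.mem_powersetCard.1 (Finset.mem_filter.1 hI).1).2
      simp only [Finset.sum_const, hI', nsmul_eq_mul]
      field_simp
    rw [e]
    refine Finset.sum_bij' (fun k _ => ⟨insert i (k.1.erase k.2), k.2⟩)
      (fun k _ => ⟨insert k.2 (k.1.erase i), k.2⟩) ?_ ?_ ?_ ?_ ?_
    · rintro ⟨I, j⟩ hk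
      simp only [Finset.mem_sigma, Finset.mem_filter, Finset.mem_powersetCard, Finset.subset_univ,
        true_and, Finset.mem_compl] at hk ⊢
      obtain ⟨⟨hI, hi⟩, hj⟩ := hk
      have hne : j ≠ i := fun h => hi (h ▸ hj)
      refine ⟨⟨?_, Finset.mem_insert_self _ _⟩, by simp [hne]⟩
      rw [Finset.card_insert_of_notMem (by simp [hi]), Finset.card_erase_of_mem hj]
      omega
    · rintro ⟨I, j⟩ hk
      simp only [Finset.mem_sigma, Finset.mem_filter, Finset.mem_powersetCard, Finset.subset_univ,
        true_and, Finset.mem_compl] at hk ⊢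
      obtain ⟨⟨hI, hi⟩, hj⟩ := hk
      have hne : j ≠ i := fun h => hj (h ▸ hi)
      refine ⟨⟨?_, by simp [hne.symm]⟩, Finset.mem_insert_self _ _⟩
      rw [Finset.card_insert_of_notMem (by simp [hj]), Finset.card_erase_of_mem hi]
      omega
    · rintro ⟨I, j⟩ hk
      simp only [Finset.mem_sigma, Finset.mem_filter] at hk
      obtain ⟨⟨-, hi⟩, hj⟩ := hk
      have h1 : i ∉ I.erase j := fun h => hi (Finset.mem_of_mem_erase h)
      simp [Finset.erase_insert h1, Finset.insert_erase hj]
    · rintro ⟨I, j⟩ hk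
      simp only [Finset.mem_sigma, Finset.mem_filter, Finset.mem_compl] at hk
      obtain ⟨⟨-, hi⟩, hj⟩ := hk
      have h1 : j ∉ I.erase i := fun h => hj (Finset.mem_of_mem_erase h)
      simp [Finset.erase_insert h1, Finset.insert_erase hi]
    · rintro ⟨I, j⟩ hk
      simp only [Finset.mem_sigma, Finset.mem_filter] at hk
      obtain ⟨⟨-, hi⟩, hj⟩ := hk
      have h1 : i ∉ I.erase j := fun h => hi (Finset.mem_of_mem_erase h)
      simp [Finset.erase_insert h1, Finset.insert_erase hj]

lemma lintegral_minibatchLaw {m b : ℕ} (g : Finset (Fin m) → ℝ≥0∞) :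
    ∫⁻ I, g I ∂(minibatchLaw m b)
      = (m.choose b : ℝ≥0∞)⁻¹ * ∑ I ∈ Finset.powersetCard b Finset.univ, g I := by
  have e : {I : Finset (Fin m) | I.card = b}
      = ((Finset.powersetCard b (Finset.univ : Finset (Fin m)) : Finset _) : Set _) := by
    ext I; simp
  rw [minibatchLaw, uniformOn, ProbabilityTheory.cond, lintegral_smul_measure, e, lintegral_finset,
    Measure.count_apply_finset, Finset.card_powersetCard]
  simp

/-- The law of a Gaussian mechanism on a random minibatch is a mixture of Gaussians. -/
lemma lintegral_minibatch_gaussian {d : ℕ} {X : Type*} [MeasurableSpace X] {m b : ℕ} (hbm : b ≤ m)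
    (A : Finset (Fin m) → Vec d) {c : ℝ} (hc : 0 < c) {f : Vec d → X} (hf : Measurable f)
    {g : X → ℝ≥0∞} (hg : Measurable g) :
    ∫⁻ x, g x ∂(((minibatchLaw m b).prod (stdGaussian (Vec d))).map
        fun q => f (A q.1 + c • q.2))
      = ∫⁻ x, ENNReal.ofReal (∑ I ∈ Finset.powersetCard b Finset.univ,
          (m.choose b : ℝ)⁻¹ * shiftDensity (c⁻¹ • A I) x) * g (f (c • x))
        ∂(stdGaussian (Vec d)) := by
  have hf' : Measurable fun v : Vec d => f (c • v) := by fun_prop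
  have hA : Measurable fun q : Finset (Fin m) × Vec d => f (A q.1 + c • q.2) :=
    measurable_from_prod_countable_right fun I => by fun_prop
  rw [lintegral_map hg hA,
    lintegral_prod (fun q => g (f (A q.1 + c • q.2))) (hg.comp hA).aemeasurable,
    lintegral_minibatchLaw]
  have e : ∀ I : Finset (Fin m), ∫⁻ x, g (f (A I + c • x)) ∂(stdGaussian (Vec d))
      = ∫⁻ x, ENNReal.ofReal (shiftDensity (c⁻¹ • A I) x) * g (f (c • x))
        ∂(stdGaussian (Vec d)) := by
    intro I
    refine Eq.trans (lintegral_congr fun x => ?_)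
      (lintegral_add_stdGaussian (c⁻¹ • A I) (hg.comp hf'))
    simp only [smul_add, smul_inv_smul₀ hc.ne', add_comm]
  have hN : (0 : ℝ) < m.choose b := by exact_mod_cast Nat.choose_pos hbm
  simp_rw [e]
  rw [← lintegral_finsetSum _ fun I _ => by fun_prop,
    ← lintegral_const_mul _ (Finset.measurable_sum _ fun I _ => by fun_prop)]
  refine lintegral_congr fun x => ?_
  rw [← Finset.sum_mul, ← mul_assoc, ← Finset.mul_sum,
    ENNReal.ofReal_mul (by positivity), ENNReal.ofReal_inv_of_pos hN, ENNReal.ofReal_natCast,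
    ENNReal.ofReal_sum_of_nonneg fun I _ => (shiftDensity_pos _ x).le]

/-- Amplification by subsampling without replacement for the Gaussian mechanism. -/
lemma RenyiLE.minibatch_gaussian {d : ℕ} {X : Type*} [MeasurableSpace X] {α : ℕ} (hα : 2 ≤ α)
    {m b : ℕ} (hb : 1 ≤ b) (hbm : b ≤ m) (i : Fin m) {A A' : Finset (Fin m) → Vec d} {c Δ : ℝ}
    (hc : 0 ≤ c) (hΔ : 0 ≤ Δ)
    (h1 : ∀ I : Finset (Fin m), i ∉ I → A I = A' I)
    (h2 : ∀ I : Finset (Fin m), I.card = b → i ∈ I → ‖A I - A' I‖ ≤ Δ * c)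
    (h3 : ∀ I : Finset (Fin m), I.card = b → i ∈ I → ∀ j, j ∉ I →
      ‖A I - A (insert j (I.erase i))‖ ≤ Δ * c)
    (h4 : ∀ I : Finset (Fin m), I.card = b → i ∈ I → ∀ j, j ∉ I →
      ‖A' I - A' (insert j (I.erase i))‖ ≤ Δ * c)
    {f : Vec d → X} (hf : Measurable f) :
    RenyiLE α (1 / ((α : ℝ) - 1) * Real.log (1 + ((b : ℝ) / m) ^ 2 * (α.choose 2 : ℝ)
        * ternaryBound Δ 2
        + ∑ j ∈ Finset.Icc 3 α, ((b : ℝ) / m) ^ j * (α.choose j : ℝ) * ternaryBound Δ j))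
      (((minibatchLaw m b).prod (stdGaussian (Vec d))).map fun q => f (A q.1 + c • q.2))
      (((minibatchLaw m b).prod (stdGaussian (Vec d))).map fun q => f (A' q.1 + c • q.2)) := by
  have hα1 : (1 : ℝ) < α := by exact_mod_cast hα
  have hb0 : (0 : ℝ) < b := by exact_mod_cast hb
  have hm0 : (0 : ℝ) < m := by exact_mod_cast hb.trans hbm
  have hγ1 : (b : ℝ) / m ≤ 1 := by rw [div_le_one hm0]; exact_mod_cast hbm
  have hmeas : ∀ A : Finset (Fin m) → Vec d,
      Measurable fun q : Finset (Fin m) × Vec d => f (A q.1 + c • q.2) :=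
    fun A => measurable_from_prod_countable_right fun I => by fun_prop
  rcases hc.eq_or_lt with rfl | hc
  · have heq : ((minibatchLaw m b).prod (stdGaussian (Vec d))).map
          (fun q => f (A q.1 + (0 : ℝ) • q.2))
        = ((minibatchLaw m b).prod (stdGaussian (Vec d))).map
          fun q => f (A' q.1 + (0 : ℝ) • q.2) := by
      refine Measure.ext_of_lintegral _ fun g hg => ?_
      rw [lintegral_map hg (hmeas A), lintegral_map hg (hmeas A'),
        lintegral_prod (fun q => g (f (A q.1 + (0 : ℝ) • q.2))) (hg.comp (hmeas A)).aemeasurable,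
        lintegral_prod (fun q => g (f (A' q.1 + (0 : ℝ) • q.2))) (hg.comp (hmeas A')).aemeasurable,
        lintegral_minibatchLaw, lintegral_minibatchLaw]
      congr 1
      refine Finset.sum_congr rfl fun I hI => ?_
      have hI' : I.card = b := (Finset.mem_powersetCard.1 hI).2
      have hAI : A I = A' I := by
        by_cases hi : i ∈ I
        · have := h2 I hI' hi
          rw [mul_zero] at this
          exact sub_eq_zero.1 (norm_le_zero_iff.1 this)
        · exact h1 I hi
      simp only [hAI]
    have := isProbabilityMeasure_minibatchLaw hbm
    have : IsProbabilityMeasure (((minibatchLaw m b).prod (stdGaussian (Vec d))).map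
        fun q => f (A q.1 + (0 : ℝ) • q.2)) :=
      Measure.isProbabilityMeasure_map (hmeas A).aemeasurable
    rw [← heq]
    refine (RenyiLE.refl hα1 _).mono hα1 ?_
    refine mul_nonneg (one_div_nonneg.2 (by linarith)) (Real.log_nonneg ?_)
    have e1 := ternaryBound_nonneg Δ 2
    have e2 : 0 ≤ ∑ j ∈ Finset.Icc 3 α, ((b : ℝ) / m) ^ j * (α.choose j : ℝ) * ternaryBound Δ j :=
      Finset.sum_nonneg fun j _ => by have := ternaryBound_nonneg Δ j; positivity
    have e3 : 0 ≤ ((b : ℝ) / m) ^ 2 * (α.choose 2 : ℝ) * ternaryBound Δ 2 := by positivity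
    linarith
  · have hs : ∀ a b : Vec d, ‖a - b‖ ≤ Δ * c → ‖c⁻¹ • a - c⁻¹ • b‖ ≤ Δ := by
      intro a b h
      rw [← smul_sub, norm_smul, norm_inv, Real.norm_of_nonneg hc.le, inv_mul_le_iff₀ hc, mul_comm]
      exact h
    have hN : (0 : ℝ) < m.choose b := by exact_mod_cast Nat.choose_pos hbm
    -- If b = m there is no index to exchange with. Then γ = 1, the third family of means has weight
    -- 0, and any choice within Δ serves.
    rcases hbm.eq_or_lt with rfl | hlt
    · have hcard : (Finset.univ : Finset (Fin b)).card = b := by simp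
      have hps : Finset.powersetCard b (Finset.univ : Finset (Fin b)) = {Finset.univ} := by
        ext I
        simp [← Finset.card_eq_iff_eq_univ]
      refine RenyiLE.mixture hα hΔ (by positivity) hγ1 ({Finset.univ} : Finset (Finset (Fin b)))
        (fun _ => 1) (by simp) (by simp) (fun I => c⁻¹ • A I) (fun I => c⁻¹ • A' I)
        (fun I => c⁻¹ • A I) ?_ ?_ ?_ (f := fun x => f (c • x)) (by fun_prop) ?_ ?_
      · intro I hI
        obtain rfl := Finset.mem_singleton.1 hI
        exact hs _ _ (h2 _ hcard (Finset.mem_univ i))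
      · intro I hI
        simpa using hΔ
      · intro I hI
        obtain rfl := Finset.mem_singleton.1 hI
        rw [norm_sub_rev]
        exact hs _ _ (h2 _ hcard (Finset.mem_univ i))
      · intro g hg
        rw [lintegral_minibatch_gaussian le_rfl A hc hf hg, hps]
        simp [div_self hb0.ne']
      · intro g hg
        rw [lintegral_minibatch_gaussian le_rfl A' hc hf hg, hps]
        simp [div_self hb0.ne']
    · have hbm' : (0 : ℝ) < (m : ℝ) - b := by
        have : (b : ℝ) < m := by exact_mod_cast hlt
        linarith
      set s := ((Finset.powersetCard b (Finset.univ : Finset (Fin m))).filter (i ∈ ·)).sigma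
        fun I => Iᶜ with hsdef
      have hs1 : ∀ k ∈ s, k.1.card = b ∧ i ∈ k.1 ∧ k.2 ∉ k.1 := by
        intro k hk
        simpa [hsdef, and_assoc] using hk
      -- The exchange identity for the constant 1 counts the pairs. It gives each pair the mass
      -- 1/|s|, with proportion b/m on I and 1 - b/m on the exchanged set.
      have hcount : (m.choose b : ℝ) = s.card * (m / (b * ((m : ℝ) - b))) := by
        have := sum_powersetCard_exchange hb hlt i (fun _ => 1)
        rw [← hsdef] at this
        simp only [Finset.sum_const, Finset.card_powersetCard, Finset.card_univ, Fintype.card_fin,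
          nsmul_eq_mul, mul_one] at this
        rw [this]
        field_simp
        ring
      have hs0 : (0 : ℝ) < s.card := by
        rcases (Nat.cast_nonneg (α := ℝ) s.card).eq_or_lt with h | h
        · rw [← h, zero_mul] at hcount
          exact absurd hcount hN.ne'
        · exact h
      have hdens : ∀ B : Finset (Fin m) → ℝ, ∑ I ∈ Finset.powersetCard b Finset.univ,
          (m.choose b : ℝ)⁻¹ * B I = ∑ k ∈ s, (s.card : ℝ)⁻¹ * ((b : ℝ) / m * B k.1
            + (1 - (b : ℝ) / m) * B (insert k.2 (k.1.erase i))) := by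
        intro B
        rw [sum_powersetCard_exchange hb hlt i]
        refine Finset.sum_congr rfl fun k _ => ?_
        rw [hcount]
        field_simp
      refine RenyiLE.mixture hα hΔ (by positivity) hγ1 s (fun _ => (s.card : ℝ)⁻¹)
        (fun _ _ => by positivity) (by simp [hs0.ne']) (fun k => c⁻¹ • A k.1)
        (fun k => c⁻¹ • A' k.1) (fun k => c⁻¹ • A (insert k.2 (k.1.erase i)))
        (fun k hk => hs _ _ (h2 _ (hs1 k hk).1 (hs1 k hk).2.1))
        (fun k hk => hs _ _ (h3 _ (hs1 k hk).1 (hs1 k hk).2.1 _ (hs1 k hk).2.2)) ?_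
        (f := fun x => f (c • x)) (by fun_prop) ?_ ?_
      · intro k hk
        obtain ⟨e1, e2, e3⟩ := hs1 k hk
        -- The exchanged minibatch misses i, so its mean is common to both laws and can be compared
        -- with `A'` as well.
        rw [h1 _ (by simp; rintro rfl; exact e3 e2)]
        exact hs _ _ (h4 _ e1 e2 _ e3)
      · intro g hg
        rw [lintegral_minibatch_gaussian hbm A hc hf hg]
        refine lintegral_congr fun x => ?_
        rw [hdens fun I => shiftDensity (c⁻¹ • A I) x]
      · intro g hg
        rw [lintegral_minibatch_gaussian hbm A' hc hf hg]
        refine lintegral_congr fun x => ?_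
        rw [hdens fun I => shiftDensity (c⁻¹ • A' I) x]
        congr 2
        refine Finset.sum_congr rfl fun k hk => ?_
        obtain ⟨e1, e2, e3⟩ := hs1 k hk
        rw [h1 (insert k.2 (k.1.erase i)) (by simp; rintro rfl; exact e3 e2)]

/-! ### Sensitivity of the clipped means -/

lemma Adjacent.exists_eq {m : ℕ} {Z : Type*} {D D' : Fin m → Z} (h : Adjacent D D') :
    ∃ i, ∀ j, j ≠ i → D j = D' j := by
  classical
  unfold Adjacent hammingDist at h
  obtain ⟨i, hi⟩ := Finset.card_eq_one.1 h
  refine ⟨i, fun j hj => ?_⟩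
  by_contra hne
  have : j ∈ ({i} : Finset (Fin m)) := by
    rw [← hi]
    simpa using hne
  exact hj (Finset.mem_singleton.1 this)

section Clipping

variable {d : ℕ} {ι : Type*} {C : ℝ}

lemma norm_clip_le (hC : 0 ≤ C) (x : Vec d) : ‖clip C x‖ ≤ C := by
  unfold clip
  rw [norm_smul, Real.norm_of_nonneg (le_min (by positivity) zero_le_one)]
  rcases (norm_nonneg x).eq_or_lt with h | h
  · rw [← h, mul_zero]; exact hC
  · calc min (C / ‖x‖) 1 * ‖x‖ ≤ C / ‖x‖ * ‖x‖ := by gcongr; exact min_le_left _ _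
      _ = C := by field_simp

lemma norm_clip_sub_clip_le (hC : 0 ≤ C) (x y : Vec d) : ‖clip C x - clip C y‖ ≤ 2 * C := by
  linarith [norm_sub_le (clip C x) (clip C y), norm_clip_le hC x, norm_clip_le hC y]

lemma norm_inv_card_smul_le {c b : ℝ} (hb : 0 ≤ b) {x : Vec d} (h : ‖x‖ ≤ c) :
    ‖(1 / b) • x‖ ≤ c / b := by
  rw [norm_smul, Real.norm_of_nonneg (by positivity), one_div, inv_mul_eq_div]
  gcongr

/-- Replacing one vector. -/
lemma norm_clippedMean_sub_le [DecidableEq ι] (hC : 0 ≤ C) (I : Finset ι) {g g' : ι → Vec d} {i : ι}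
    (h : ∀ j, j ≠ i → g j = g' j) :
    ‖clippedMean I g C - clippedMean I g' C‖ ≤ 2 * C / I.card := by
  unfold clippedMean
  rw [← smul_sub, ← Finset.sum_sub_distrib]
  refine norm_inv_card_smul_le (by positivity) ?_
  by_cases hi : i ∈ I
  · rw [Finset.sum_eq_single_of_mem i hi fun j _ hj => by rw [h j hj, sub_self]]
    exact norm_clip_sub_clip_le hC _ _
  · rw [Finset.sum_eq_zero fun j hj => by
      rw [h j (fun e => hi (e ▸ hj)), sub_self], norm_zero]
    positivity

/-- Exchanging one index. -/
lemma norm_clippedMean_sub_exchange_le [DecidableEq ι] (hC : 0 ≤ C) {I : Finset ι} (g : ι → Vec d)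
    {i j : ι} (hi : i ∈ I) (hj : j ∉ I) :
    ‖clippedMean I g C - clippedMean (insert j (I.erase i)) g C‖ ≤ 2 * C / I.card := by
  have hj' : j ∉ I.erase i := fun h => hj (Finset.mem_of_mem_erase h)
  have hcard : (insert j (I.erase i)).card = I.card := by
    rw [Finset.card_insert_of_notMem hj', Finset.card_erase_add_one hi]
  unfold clippedMean
  rw [hcard, ← smul_sub, Finset.sum_insert hj', ← Finset.add_sum_erase I _ hi]
  refine norm_inv_card_smul_le (by positivity) ?_
  rw [add_sub_add_right_eq_sub]
  exact norm_clip_sub_clip_le hC _ _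

end Clipping

/-! ### The level `ε'` -/

lemma cap_top {j : ℕ} (hj : j ≠ 0) : (min 2 ((EReal.exp ⊤ - 1) ^ j) : ℝ≥0∞).toReal = 2 := by
  rw [EReal.exp_top, ENNReal.top_sub ENNReal.one_ne_top, ENNReal.top_pow hj]
  simp

/-- With Δ = 2/(b σ₃) one has ε(2) = Δ² and (j-1) ε(j) = j(j-1)Δ²/2, while ε(∞) = ∞ turns every cap
into 2. So the level in the statement is what the Gaussian amplification bound produces. -/
lemma epsPrime_eq (γ : ℝ) (b : ℕ) (σ₃ : ℝ) (α : ℕ) :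
    epsPrime γ b σ₃ α = 1 / ((α : ℝ) - 1) * Real.log (1
      + γ ^ 2 * (α.choose 2 : ℝ) * ternaryBound (2 / (b * σ₃)) 2
      + ∑ j ∈ Finset.Icc 3 α, γ ^ j * (α.choose j : ℝ) * ternaryBound (2 / (b * σ₃)) j) := by
  unfold epsPrime subsampledRDP
  have e : (2 / (b * σ₃)) ^ 2 = 2 * 2 / ((b : ℝ) ^ 2 * σ₃ ^ 2) := by rw [div_pow, mul_pow]; norm_num
  simp only [cap_top two_ne_zero]
  have e2 : min (4 * (Real.exp (2 * ((2 : ℕ) : ℝ) / ((b : ℝ) ^ 2 * σ₃ ^ 2)) - 1))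
      (Real.exp (2 * ((2 : ℕ) : ℝ) / ((b : ℝ) ^ 2 * σ₃ ^ 2)) * 2)
      = ternaryBound (2 / (b * σ₃)) 2 := by
    rw [ternaryBound, if_pos rfl, e, Nat.cast_ofNat]
  rw [e2]
  congr 3
  refine Finset.sum_congr rfl fun j hj => ?_
  have hj3 : 3 ≤ j := (Finset.mem_Icc.1 hj).1
  rw [cap_top (by omega), ternaryBound, if_neg (by omega), mul_assoc _ (Real.exp _), e]
  congr 3
  ring

lemma one_le_subsampled {γ : ℝ} (hγ : 0 ≤ γ) (Δ : ℝ) (α : ℕ) :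
    1 ≤ 1 + γ ^ 2 * (α.choose 2 : ℝ) * ternaryBound Δ 2
      + ∑ j ∈ Finset.Icc 3 α, γ ^ j * (α.choose j : ℝ) * ternaryBound Δ j := by
  have e1 := ternaryBound_nonneg Δ 2
  have e2 : 0 ≤ ∑ j ∈ Finset.Icc 3 α, γ ^ j * (α.choose j : ℝ) * ternaryBound Δ j :=
    Finset.sum_nonneg fun j _ => by have := ternaryBound_nonneg Δ j; positivity
  have e3 : 0 ≤ γ ^ 2 * (α.choose 2 : ℝ) * ternaryBound Δ 2 := by positivity
  linarith

lemma epsPrime_nonneg {γ : ℝ} (hγ : 0 ≤ γ) (b : ℕ) (σ₃ : ℝ) {α : ℕ} (hα : 2 ≤ α) :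
    0 ≤ epsPrime γ b σ₃ α := by
  have hα1 : (2 : ℝ) ≤ α := by exact_mod_cast hα
  rw [epsPrime_eq]
  exact mul_nonneg (one_div_nonneg.2 (by linarith)) (Real.log_nonneg (one_le_subsampled hγ _ _))

/-- Lets a single condition at ratio b/n_min cover every client, since n_p ≥ n_min. -/
lemma epsPrime_mono {γ γ' : ℝ} (hγ : 0 ≤ γ) (h : γ ≤ γ') (b : ℕ) (σ₃ : ℝ) {α : ℕ} (hα : 2 ≤ α) :
    epsPrime γ b σ₃ α ≤ epsPrime γ' b σ₃ α := by
  have hα1 : (2 : ℝ) ≤ α := by exact_mod_cast hα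
  rw [epsPrime_eq, epsPrime_eq]
  refine mul_le_mul_of_nonneg_left ?_ (one_div_nonneg.2 (by linarith))
  refine Real.log_le_log (by linarith [one_le_subsampled hγ (2 / (b * σ₃)) α]) ?_
  have := ternaryBound_nonneg (2 / (b * σ₃)) 2
  gcongr with j _
  exact ternaryBound_nonneg _ _

/-! ### The steps of the algorithm -/

section Steps

variable {d P : ℕ} {n : Fin P → ℕ} {Z : Type*}

lemma RenyiLE.assign_refl {α : ℝ} (hα : 1 < α) {W : Type*} [MeasurableSpace W] (ν : Measure W)
    [IsProbabilityMeasure ν] (y : Slot) {F : Memory d × W → Vec d} (hF : Measurable F)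
    (s : Memory d) : RenyiLE α 0 (assign ν y F hF s) (assign ν y F hF s) :=
  RenyiLE.refl hα _

/-- Only the mean of client p changes, and only in one clipped vector. In rounds without restart the
previous estimator is read from the same memory and cancels. The factor `serverStd A 1 1 r s` is the
clipping radius of the round. -/
lemma norm_serverMean_sub_le (A : Config d n Z) {p : Fin P}
    {D D' : ∀ q, Fin (n q) → Z} (hD : ∀ q, q ≠ p → D q = D' q) (hp : Adjacent (D p) (D' p))
    (r : ℕ) (s : Memory d) :
    ‖serverMean A D r s - serverMean A D' r s‖
      ≤ 2 / (n p * P) * serverStd A 1 1 r s := by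
  obtain ⟨i, hi⟩ := hp.exists_eq
  have hP : 0 ≤ (P : ℝ) := by positivity
  have key : ∀ (C : ℝ) (_ : 0 ≤ C) (g : Z → Vec d),
      ‖(1 / (P : ℝ)) • ∑ q, clippedMean Finset.univ (fun i => g (D q i)) C
        - (1 / (P : ℝ)) • ∑ q, clippedMean Finset.univ (fun i => g (D' q i)) C‖
        ≤ 2 / (n p * P) * C := by
    intro C hC g
    rw [← smul_sub, ← Finset.sum_sub_distrib, Finset.sum_eq_single_of_mem p (Finset.mem_univ _)
      fun q _ hq => by rw [hD q hq, sub_self]]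
    refine (norm_inv_card_smul_le hP (norm_clippedMean_sub_le hC Finset.univ (i := i)
      fun j hj => by rw [hi j hj])).trans_eq ?_
    rw [Finset.card_univ, Fintype.card_fin]
    ring
  unfold serverMean serverStd
  split_ifs
  · rw [one_mul]
    exact key _ A.C₁_pos.le fun z => grad A.loss (s (.x 0 (r - 1))) z
  · rw [add_sub_add_right_eq_sub, one_mul]
    exact key _ (by have := A.C₂_pos; positivity) fun z =>
      grad A.loss (s (.x 0 (r - 1))) z - grad A.loss (s (.x 0 (r - 2))) z

/-- The privacy loss of the server in round `r`. -/
noncomputable def serverCost (A : Config d n Z) (p : Fin P) (σ₁ σ₂ : ℝ) (α r : ℕ) : ℝ :=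
  if (r - 1) % A.T = 0 then 2 * (α : ℝ) / ((n p : ℝ) ^ 2 * (P : ℝ) ^ 2 * σ₁ ^ 2)
  else 2 * (α : ℝ) / ((n p : ℝ) ^ 2 * (P : ℝ) ^ 2 * σ₂ ^ 2)

/-- In either kind of round the noise is σ times the clipping radius, so the radius cancels and Δ =
2/(n_p P σ). Positivity of σ₂ is asked only where σ₂ is used, to allow σ₂ = 0 when T = 1. -/
lemma RenyiLE.serverStep (A : Config d n Z) {p : Fin P} {D D' : ∀ q, Fin (n q) → Z}
    (hD : ∀ q, q ≠ p → D q = D' q) (hp : Adjacent (D p) (D' p)) {σ₁ σ₂ : ℝ} {α r : ℕ}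
    (hα : 2 ≤ α) (hσ₁ : 0 < σ₁) (hσ₂ : (r - 1) % A.T ≠ 0 → 0 < σ₂) (s : Memory d) :
    RenyiLE α (serverCost A p σ₁ σ₂ α r) (serverStep A σ₁ σ₂ D r s)
      (serverStep A σ₁ σ₂ D' r s) := by
  have hdiff := norm_serverMean_sub_le A hD hp r s
  obtain ⟨σ, hσ, hstd, hcost⟩ : ∃ σ : ℝ, 0 < σ ∧
      DIFF2.serverStd A σ₁ σ₂ r s = σ * DIFF2.serverStd A 1 1 r s ∧
      serverCost A p σ₁ σ₂ α r = 2 * (α : ℝ) / ((n p : ℝ) ^ 2 * (P : ℝ) ^ 2 * σ ^ 2) := by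
    by_cases h : (r - 1) % A.T = 0
    · exact ⟨σ₁, hσ₁, by simp [serverStd, h], by simp [serverCost, h]⟩
    · exact ⟨σ₂, hσ₂ h, by simp [serverStd, h], by simp [serverCost, h]⟩
  have hstd0 : 0 ≤ DIFF2.serverStd A 1 1 r s := by
    have := A.C₁_pos
    have := A.C₂_pos
    unfold serverStd
    split_ifs <;> positivity
  have e : serverCost A p σ₁ σ₂ α r = α * (2 / (n p * P * σ)) ^ 2 / 2 := by
    rw [hcost]
    ring
  rw [e]
  refine RenyiLE.gaussian (d := d) hα (a := serverMean A D r s) (b := serverMean A D' r s)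
    (c := DIFF2.serverStd A σ₁ σ₂ r s) ?_ ?_
    (f := fun v => Function.update s (.v 1 r) v) (measurable_update s)
  · refine hdiff.trans_eq ?_
    rw [hstd]
    field_simp
  · rw [hstd]
    positivity

/-- The radius depends on the memory only. Changing a record of the minibatch and exchanging an
index both replace one clipped vector out of b, hence Δ = 2/(b σ₃) in all the comparisons. -/
lemma RenyiLE.localStep (A : Config d n Z) {m : ℕ} (hbm : A.b ≤ m) {D D' : Fin m → Z}
    (h : Adjacent D D') {σ₃ : ℝ} (hσ₃ : 0 < σ₃) {α : ℕ} (hα : 2 ≤ α) (k r : ℕ) (s : Memory d) :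
    RenyiLE α (epsPrime ((A.b : ℝ) / m) A.b σ₃ α) (localStep A σ₃ D k r s)
      (localStep A σ₃ D' k r s) := by
  obtain ⟨i, hi⟩ := h.exists_eq
  have hC : 0 ≤ localRadius A k r s := by
    have := A.C₃_pos
    unfold localRadius
    positivity
  have hb : (0 : ℝ) < A.b := by exact_mod_cast A.b_pos
  have e : 2 / (A.b * σ₃) * (σ₃ * localRadius A k r s) = 2 * localRadius A k r s / A.b := by
    field_simp
  rw [epsPrime_eq]
  refine RenyiLE.minibatch_gaussian (d := d) hα A.b_pos hbm i (A := localMean A D k r s)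
    (A' := localMean A D' k r s) (c := σ₃ * localRadius A k r s) (by positivity) (by positivity)
    ?_ ?_ ?_ ?_ (f := fun v => Function.update s (.v k r) v) (measurable_update s)
  · intro I hI
    unfold localMean clippedMean
    congr 2
    exact Finset.sum_congr rfl fun j hj => by simp only [hi j fun e => hI (e ▸ hj)]
  · intro I hI _
    rw [e, ← hI]
    unfold localMean
    rw [add_sub_add_right_eq_sub]
    exact norm_clippedMean_sub_le hC I (i := i) fun j hj => by rw [hi j hj]
  · intro I hI hiI j hj
    rw [e, ← hI]
    unfold localMean
    rw [add_sub_add_right_eq_sub]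
    exact norm_clippedMean_sub_exchange_le hC _ hiI hj
  · intro I hI hiI j hj
    rw [e, ← hI]
    unfold localMean
    rw [add_sub_add_right_eq_sub]
    exact norm_clippedMean_sub_exchange_le hC _ hiI hj

lemma RenyiLE.localLoop (A : Config d n Z) {m : ℕ} {D D' : Fin m → Z} {σ₃ ε α : ℝ} (hα : 1 < α)
    {r : ℕ} (h : ∀ k s, RenyiLE α ε (DIFF2.localStep A σ₃ D k r s) (DIFF2.localStep A σ₃ D' k r s))
    (j : ℕ) (s : Memory d) :
    RenyiLE α (j * ε) (localLoop A σ₃ D r j s) (localLoop A σ₃ D' r j s) := by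
  induction j generalizing s with
  | zero =>
    simp only [DIFF2.localLoop, Nat.cast_zero, zero_mul]
    exact RenyiLE.refl hα _
  | succ j ih =>
    have h1 := fun s => RenyiLE.assign_refl (d := d) hα (Measure.dirac ()) (.x (j + 2) (r - 1))
      (F := fun q => q.1 (.x (j + 2 - 1) (r - 1)) - A.η • q.1 (.v (j + 2) r)) (by fun_prop) s
    refine (RenyiLE.comp hα ih (RenyiLE.comp hα (h (j + 2)) h1) s).mono hα (le_of_eq ?_)
    push_cast
    ring

/-- The privacy loss of round `r`. -/
noncomputable def roundCost [NeZero P] (A : Config d n Z) (p : Fin P) (σ₁ σ₂ σ₃ : ℝ) (α r : ℕ) :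
    ℝ :=
  serverCost A p σ₁ σ₂ α r
    + if client P r = p then (A.K : ℝ) * epsPrime ((A.b : ℝ) / n p) A.b σ₃ α else 0

lemma RenyiLE.round [NeZero P] (A : Config d n Z) {p : Fin P} {D D' : ∀ q, Fin (n q) → Z}
    (hD : ∀ q, q ≠ p → D q = D' q) (hp : Adjacent (D p) (D' p)) {σ₁ σ₂ σ₃ : ℝ} {α r : ℕ}
    (hα : 2 ≤ α) (hσ₁ : 0 < σ₁) (hσ₂ : (r - 1) % A.T ≠ 0 → 0 < σ₂) (hσ₃ : 0 < σ₃) (s : Memory d) :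
    RenyiLE α (roundCost A p σ₁ σ₂ σ₃ α r) (round A σ₁ σ₂ σ₃ D r s) (round A σ₁ σ₂ σ₃ D' r s) := by
  have hα1 : (1 : ℝ) < α := by exact_mod_cast hα
  have := isProbabilityMeasure_indexLaw A.K_pos
  have hε := epsPrime_nonneg (γ := (A.b : ℝ) / n p) (by positivity) A.b σ₃ hα
  have hloop : ∀ s, RenyiLE α
      (if client P r = p then (A.K : ℝ) * epsPrime ((A.b : ℝ) / n p) A.b σ₃ α else 0)
      (DIFF2.localLoop A σ₃ (D (client P r)) r (A.K - 1) s)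
      (DIFF2.localLoop A σ₃ (D' (client P r)) r (A.K - 1) s) := by
    intro s
    split_ifs with hc
    · rw [hc]
      refine (RenyiLE.localLoop A hα1 (RenyiLE.localStep A (A.b_le p) hp hσ₃ hα · r) _ s).mono
        hα1 ?_
      gcongr
      -- The loop makes K - 1 passes; the stated cost allows for K.
      exact Nat.sub_le _ _
    · have := isProbabilityMeasure_minibatchLaw (A.b_le (client P r))
      rw [hD _ hc]
      refine (RenyiLE.localLoop A hα1 (ε := 0) (fun k s => ?_) _ s).mono hα1 (by simp)
      exact RenyiLE.assign_refl hα1 _ _ _ s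
  have hdescent : ∀ s, RenyiLE α 0 (descentStep A 1 r s) (descentStep A 1 r s) :=
    fun s => RenyiLE.assign_refl hα1 _ _ _ s
  have hreturn : ∀ s, RenyiLE α 0 (returnStep A r s) (returnStep A r s) :=
    fun s => RenyiLE.assign_refl hα1 _ _ _ s
  have hout : ∀ s, RenyiLE α 0 (outStep A r s) (outStep A r s) :=
    fun s => RenyiLE.assign_refl hα1 _ _ _ s
  refine (RenyiLE.comp hα1 (RenyiLE.serverStep A hD hp hα hσ₁ hσ₂) (RenyiLE.comp hα1 hdescent
    (RenyiLE.comp hα1 hloop (RenyiLE.comp hα1 hreturn hout))) s).mono hα1 (le_of_eq ?_)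
  unfold roundCost
  ring

/-- Composition over rounds. The whole memory is carried along, so later rounds may depend on
everything before. Round r + 1 is a restart exactly when T divides r. -/
lemma RenyiLE.lawAfter [NeZero P] (A : Config d n Z) {p : Fin P} {D D' : ∀ q, Fin (n q) → Z}
    (hD : ∀ q, q ≠ p → D q = D' q) (hp : Adjacent (D p) (D' p)) {σ₁ σ₂ σ₃ : ℝ} {α : ℕ}
    (hα : 2 ≤ α) (hσ₁ : 0 < σ₁) (hσ₃ : 0 < σ₃) (N : ℕ) (hσ₂ : ∀ r < N, r % A.T ≠ 0 → 0 < σ₂) :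
    RenyiLE α (∑ r ∈ Finset.range N, roundCost A p σ₁ σ₂ σ₃ α (r + 1))
      (lawAfter A σ₁ σ₂ σ₃ D N) (lawAfter A σ₁ σ₂ σ₃ D' N) := by
  have hα1 : (1 : ℝ) < α := by exact_mod_cast hα
  induction N with
  | zero =>
    simp only [DIFF2.lawAfter, Finset.range_zero, Finset.sum_empty]
    exact RenyiLE.refl hα1 _
  | succ N ih =>
    rw [Finset.sum_range_succ]
    exact (ih fun r hr => hσ₂ r (hr.trans N.lt_succ_self)).bind hα1
      (RenyiLE.round A hD hp hα hσ₁ (hσ₂ N N.lt_succ_self) hσ₃)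

end Steps

/-! ### Counting the rounds -/

lemma card_filter_modEq {m : ℕ} (hm : 0 < m) (N v : ℕ) :
    (((Finset.range N).filter (· ≡ v [MOD m])).card : ℝ) = (⌈((N : ℝ) - (v % m : ℕ)) / m⌉ : ℝ) := by
  rw [← Nat.count_eq_card_filter_range]
  have h := Nat.count_modEq_card_eq_ceil N hm v
  have e : ((N : ℝ) - (v % m : ℕ)) / m = (((N - (v % m : ℕ)) / m : ℚ) : ℝ) := by push_cast; rfl
  rw [e, Rat.ceil_cast, ← h]
  simp

lemma card_filter_mod_eq_zero {m : ℕ} (hm : 0 < m) (N : ℕ) :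
    (((Finset.range N).filter (· % m = 0)).card : ℝ) = (⌈(N : ℝ) / m⌉ : ℝ) := by
  have h := card_filter_modEq hm N 0
  simp only [Nat.ModEq, Nat.zero_mod, Nat.cast_zero, sub_zero] at h
  rw [← h]
  congr 2

/-- The number of rounds that are not restarts. -/
lemma card_filter_mod_ne_zero {m : ℕ} (hm : 0 < m) (N : ℕ) :
    (((Finset.range N).filter (¬ · % m = 0)).card : ℝ) = N - (⌈(N : ℝ) / m⌉ : ℝ) := by
  have := Finset.card_filter_add_card_filter_not (s := Finset.range N) (· % m = 0)
  rw [Finset.card_range] at this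
  rw [← card_filter_mod_eq_zero hm, eq_sub_iff_add_eq, add_comm]
  exact_mod_cast this

/-- The rounds r + 1 that visit client p form one residue class of r, namely p - 1 modulo P, written
p + (P - 1) to stay in ℕ. -/
lemma card_filter_client_le {P : ℕ} [NeZero P] (p : Fin P) (N : ℕ) :
    (((Finset.range N).filter fun r => client P (r + 1) = p).card : ℝ) ≤ (⌈(N : ℝ) / P⌉ : ℝ) := by
  have hP : 0 < P := NeZero.pos P
  have hsub : (Finset.range N).filter (fun r => client P (r + 1) = p)
      ⊆ (Finset.range N).filter (· ≡ p + (P - 1) [MOD P]) := by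
    intro r hr
    simp only [Finset.mem_filter] at hr ⊢
    refine ⟨hr.1, ?_⟩
    have h1 : (r + 1) % P = p := by rw [← hr.2]; rfl
    have h2 : r + 1 ≡ p [MOD P] := by
      unfold Nat.ModEq
      rw [h1, Nat.mod_eq_of_lt p.2]
    have h3 : r + P ≡ p + (P - 1) [MOD P] := by
      have := h2.add_right (P - 1)
      rwa [show r + 1 + (P - 1) = r + P by omega] at this
    exact (by simp [Nat.ModEq] : r ≡ r + P [MOD P]).trans h3
  calc _ ≤ (((Finset.range N).filter (· ≡ p + (P - 1) [MOD P])).card : ℝ) := by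
        exact_mod_cast Finset.card_le_card hsub
    _ = _ := card_filter_modEq hP N _
    _ ≤ _ := by
      have : ((N : ℝ) - ((p + (P - 1)) % P : ℕ)) / P ≤ N / P := by
        gcongr
        simp
      exact_mod_cast Int.ceil_mono this

section Privacy

variable {d P : ℕ} {n : Fin P → ℕ} {Z : Type*}

lemma sum_roundCost_le [NeZero P] (A : Config d n Z) (p : Fin P) (σ₁ σ₂ σ₃ : ℝ) {α : ℕ}
    (hα : 2 ≤ α) :
    ∑ r ∈ Finset.range A.R, roundCost A p σ₁ σ₂ σ₃ α (r + 1)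
      ≤ 2 * (α : ℝ) * (⌈(A.R : ℝ) / A.T⌉ : ℝ) / ((n p : ℝ) ^ 2 * (P : ℝ) ^ 2 * σ₁ ^ 2)
        + 2 * (α : ℝ) * ((A.R : ℝ) - (⌈(A.R : ℝ) / A.T⌉ : ℝ))
            / ((n p : ℝ) ^ 2 * (P : ℝ) ^ 2 * σ₂ ^ 2)
        + (A.K : ℝ) * (⌈(A.R : ℝ) / P⌉ : ℝ) * epsPrime ((A.b : ℝ) / n p) A.b σ₃ α := by
  have hε := epsPrime_nonneg (γ := (A.b : ℝ) / n p) (by positivity) A.b σ₃ hα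
  have h1 := card_filter_mod_eq_zero A.T_pos A.R
  have h2 := card_filter_mod_ne_zero A.T_pos A.R
  have h3 := card_filter_client_le p A.R
  simp only [roundCost, serverCost, Nat.add_sub_cancel, Finset.sum_add_distrib]
  rw [Finset.sum_ite, Finset.sum_ite, Finset.sum_const, Finset.sum_const, Finset.sum_const,
    Finset.sum_const_zero, nsmul_eq_mul, nsmul_eq_mul, nsmul_eq_mul, h1, h2,
    add_zero]
  have : (((Finset.range A.R).filter fun r => client P (r + 1) = p).card : ℝ)
      * ((A.K : ℝ) * epsPrime ((A.b : ℝ) / n p) A.b σ₃ α)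
      ≤ (⌈(A.R : ℝ) / P⌉ : ℝ) * ((A.K : ℝ) * epsPrime ((A.b : ℝ) / n p) A.b σ₃ α) := by gcongr
  refine (add_le_add le_rfl this).trans (le_of_eq ?_)
  ring

/-- The privacy level of the mechanism; `σ₂` is only used if some round is not a restart. -/
theorem isDP_mechanism [NeZero P] (A : Config d n Z) {σ₁ σ₂ σ₃ δ : ℝ} {α : ℕ} (hσ₁ : 0 < σ₁)
    (hσ₂ : ∀ r < A.R, r % A.T ≠ 0 → 0 < σ₂) (hσ₃ : 0 < σ₃) (hδ : 0 < δ) (hα : 2 ≤ α) (p : Fin P) :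
    IsDP (mechanism A σ₁ σ₂ σ₃) p
      (2 * (α : ℝ) * (⌈(A.R : ℝ) / A.T⌉ : ℝ) / ((n p : ℝ) ^ 2 * (P : ℝ) ^ 2 * σ₁ ^ 2)
        + 2 * (α : ℝ) * ((A.R : ℝ) - (⌈(A.R : ℝ) / A.T⌉ : ℝ))
            / ((n p : ℝ) ^ 2 * (P : ℝ) ^ 2 * σ₂ ^ 2)
        + (A.K : ℝ) * (⌈(A.R : ℝ) / P⌉ : ℝ) * epsPrime ((A.b : ℝ) / n p) A.b σ₃ α
        + Real.log (1 / δ) / ((α : ℝ) - 1)) δ := by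
  intro D D' hD hp S hS
  have hα1 : (1 : ℝ) < α := by exact_mod_cast hα
  have := isProbabilityMeasure_mechanism A σ₁ σ₂ σ₃ D'
  have h := ((RenyiLE.lawAfter A hD hp hα hσ₁ hσ₃ A.R hσ₂).mono hα1
    (sum_roundCost_le A p σ₁ σ₂ σ₃ hα)).map (f := fun s (i : Fin A.R) =>
      (s (.x 0 (i + 1)), s (.out (i + 1)), s (.v 1 (i + 1)))) (by fun_prop)
  have : IsFiniteMeasure ((lawAfter A σ₁ σ₂ σ₃ D' A.R).map fun s (i : Fin A.R) =>
      (s (.x 0 (i + 1)), s (.out (i + 1)), s (.v 1 (i + 1)))) :=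
    inferInstanceAs (IsFiniteMeasure (mechanism A σ₁ σ₂ σ₃ D'))
  exact h.measure_le hα1 hδ hS

end Privacy

/-! ### Noise levels for a prescribed privacy level -/

lemma nMin_le {P : ℕ} (n : Fin P → ℕ) (p : Fin P) : nMin n ≤ n p := ciInf_le' n p

lemma IsDP.mono {P : ℕ} {n : Fin P → ℕ} {Z Y : Type*} [MeasurableSpace Y]
    {M : (∀ q, Fin (n q) → Z) → Measure Y} {p : Fin P} {ε ε' δ : ℝ} (h : IsDP M p ε δ)
    (hε : ε ≤ ε') : IsDP M p ε' δ := by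
  intro D D' hD hp S hS
  refine (h D D' hD hp S hS).trans ?_
  gcongr

lemma ceil_div_le {m N : ℕ} (hm : 1 ≤ m) : (⌈(N : ℝ) / m⌉ : ℝ) ≤ N := by
  have : (N : ℝ) / m ≤ (N : ℤ) := by
    push_cast
    exact div_le_self (by positivity) (by exact_mod_cast hm)
  exact_mod_cast Int.ceil_le.2 this

/-- Here c counts the rounds, s is the squared noise multiplier, and X ≤ Y come from n_min ≤ n_p. If
c = 0 then s = 0 as well, and the quotient is 0 by convention; this is the case T = 1 for the second
noise. -/
lemma cost_le {a c u X Y s ε : ℝ} (ha : 0 < a) (hc : 0 ≤ c) (hu : 0 < u) (hX : 0 < X) (hXY : X ≤ Y)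
    (hε : 0 < ε) (hs : s = 4 * u * a * c / (X * ε)) : 2 * a * c / (Y * s) ≤ ε / (2 * u) := by
  rcases hc.eq_or_lt with rfl | hc
  · simp only [mul_zero, zero_div]
    positivity
  · have hs0 : 0 < s := by rw [hs]; positivity
    calc 2 * a * c / (Y * s) ≤ 2 * a * c / (X * s) := by gcongr
      _ = ε / (2 * u) := by
        rw [hs]
        field_simp
        norm_num

section Calibration

variable {d P : ℕ} {n : Fin P → ℕ} {Z : Type*}

lemma Config.b_le_nMin [NeZero P] (A : Config d n Z) : A.b ≤ nMin n := le_ciInf A.b_le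

/-- The sufficient condition for a prescribed privacy level. -/
theorem isDP_of_noise [NeZero P] (A : Config d n Z) {u₁ u₂ ε δ σ₁ σ₂ σ₃ : ℝ} {α : ℕ}
    (hu₁ : 1 < u₁) (hu₂ : 1 < u₂) (hε : 0 < ε) (hδ : 0 < δ) (hδ1 : δ < 1) (hσ₁ : 0 ≤ σ₁)
    (hσ₂ : 0 ≤ σ₂) (hσ₃ : 0 < σ₃) (hα : α = 1 + ⌈2 * Real.log (1 / δ) / ε⌉₊)
    (h₁ : σ₁ ^ 2 = 4 * u₁ * α * (⌈(A.R : ℝ) / A.T⌉ : ℝ) / ((nMin n : ℝ) ^ 2 * (P : ℝ) ^ 2 * ε))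
    (h₂ : σ₂ ^ 2 = 4 * u₂ * α * ((A.R : ℝ) - (⌈(A.R : ℝ) / A.T⌉ : ℝ))
      / ((nMin n : ℝ) ^ 2 * (P : ℝ) ^ 2 * ε))
    (h₃ : 2 * (A.K : ℝ) * (⌈(A.R : ℝ) / P⌉ : ℝ) * epsPrime ((A.b : ℝ) / nMin n) A.b σ₃ α
      ≤ (1 - 1 / u₁ - 1 / u₂) * ε) (p : Fin P) :
    IsDP (mechanism A σ₁ σ₂ σ₃) p ε δ := by
  have hL : 0 < Real.log (1 / δ) := Real.log_pos (by rw [lt_div_iff₀ hδ]; linarith)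
  have hceil : 0 < ⌈2 * Real.log (1 / δ) / ε⌉₊ := Nat.ceil_pos.2 (by positivity)
  have hα2 : 2 ≤ α := by omega
  have hα0 : (0 : ℝ) < α := by positivity
  have hP : (0 : ℝ) < P := by exact_mod_cast NeZero.pos P
  have hn : (0 : ℝ) < nMin n := by exact_mod_cast A.b_pos.trans A.b_le_nMin
  have hnp : (nMin n : ℝ) ≤ n p := by exact_mod_cast nMin_le n p
  have hR : (0 : ℝ) < A.R := by exact_mod_cast A.R_pos
  have hT : (0 : ℝ) < A.T := by exact_mod_cast A.T_pos
  have hc1 : (0 : ℝ) < (⌈(A.R : ℝ) / A.T⌉ : ℝ) := by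
    exact_mod_cast Int.ceil_pos.2 (by positivity)
  have hc2 : (0 : ℝ) ≤ (A.R : ℝ) - (⌈(A.R : ℝ) / A.T⌉ : ℝ) := sub_nonneg.2 (ceil_div_le A.T_pos)
  have hX : 0 < (nMin n : ℝ) ^ 2 * (P : ℝ) ^ 2 := by positivity
  have hXY : (nMin n : ℝ) ^ 2 * (P : ℝ) ^ 2 ≤ (n p : ℝ) ^ 2 * (P : ℝ) ^ 2 := by gcongr
  have hσ₁' : 0 < σ₁ := by
    refine hσ₁.lt_of_ne' fun h => ?_
    have : 0 < σ₁ ^ 2 := by rw [h₁]; positivity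
    rw [h] at this
    norm_num at this
  -- One round that is not a restart makes R - ⌈R/T⌉ positive, and then the formula forces σ₂ ≠ 0.
  have hσ₂' : ∀ r < A.R, r % A.T ≠ 0 → 0 < σ₂ := by
    intro r hr hrT
    have hpos : 0 < (A.R : ℝ) - (⌈(A.R : ℝ) / A.T⌉ : ℝ) := by
      rw [← card_filter_mod_ne_zero A.T_pos]
      exact_mod_cast Finset.card_pos.2 ⟨r, by simp [hr, hrT]⟩
    refine hσ₂.lt_of_ne' fun h => ?_
    have : 0 < σ₂ ^ 2 := by rw [h₂]; positivity
    rw [h] at this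
    norm_num at this
  refine (isDP_mechanism A hσ₁' hσ₂' hσ₃ hδ hα2 p).mono ?_
  have e1 := cost_le hα0 hc1.le (by linarith : 0 < u₁) hX hXY hε h₁
  have e2 := cost_le hα0 hc2 (by linarith : 0 < u₂) hX hXY hε h₂
  have hbγ : (A.b : ℝ) / n p ≤ A.b / nMin n := by gcongr
  have e3 : (A.K : ℝ) * (⌈(A.R : ℝ) / P⌉ : ℝ) * epsPrime ((A.b : ℝ) / n p) A.b σ₃ α
      ≤ (1 - 1 / u₁ - 1 / u₂) * ε / 2 := by
    have := epsPrime_mono (by positivity) hbγ A.b σ₃ hα2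
    have hc : (0 : ℝ) ≤ (⌈(A.R : ℝ) / P⌉ : ℝ) := by
      exact_mod_cast Int.ceil_nonneg (by positivity)
    have : (A.K : ℝ) * (⌈(A.R : ℝ) / P⌉ : ℝ) * epsPrime ((A.b : ℝ) / n p) A.b σ₃ α
      ≤ (A.K : ℝ) * (⌈(A.R : ℝ) / P⌉ : ℝ) * epsPrime ((A.b : ℝ) / nMin n) A.b σ₃ α := by gcongr
    linarith
  have e4 : Real.log (1 / δ) / ((α : ℝ) - 1) ≤ ε / 2 := by
    have h := Nat.le_ceil (2 * Real.log (1 / δ) / ε)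
    have hα' : (α : ℝ) - 1 = ⌈2 * Real.log (1 / δ) / ε⌉₊ := by rw [hα]; push_cast; ring
    rw [div_le_iff₀ hε] at h
    rw [hα', div_le_iff₀ (by exact_mod_cast hceil)]
    linarith
  have e5 : ε / (2 * u₁) = 1 / u₁ * ε / 2 := by ring
  have e6 : ε / (2 * u₂) = 1 / u₂ * ε / 2 := by ring
  linarith

end Calibration

/-! ### The order of the noise levels -/

/-- From C(α, j) = α(α-1)/(j(j-1)) · C(α-2, j-2) and j(j-1) ≥ 6. The factor α - 1 is kept in order
to cancel the prefactor 1/(α-1) of ε'. -/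
lemma choose_le_of_three_le {α j : ℕ} (hj : 3 ≤ j) (hα : 2 ≤ α) :
    (α.choose j : ℝ) ≤ ((α : ℝ) - 1) * (α : ℝ) ^ (j - 1) / 6 := by
  obtain ⟨a, rfl⟩ : ∃ a, α = a + 2 := ⟨α - 2, by omega⟩
  obtain ⟨i, rfl⟩ : ∃ i, j = i + 3 := ⟨j - 3, by omega⟩
  have h1 : ((a + 1 + 1 : ℕ) : ℝ) * (a + 1).choose (i + 2) = (a + 2).choose (i + 3) * (i + 3 : ℕ) := by
    exact_mod_cast Nat.add_one_mul_choose_eq (a + 1) (i + 2)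
  have h2 : ((a + 1 : ℕ) : ℝ) * a.choose (i + 1) = (a + 1).choose (i + 2) * (i + 2 : ℕ) := by
    exact_mod_cast Nat.add_one_mul_choose_eq a (i + 1)
  have h3 : (a.choose (i + 1) : ℝ) ≤ ((a + 2 : ℕ) : ℝ) ^ (i + 1) := by
    have : a.choose (i + 1) ≤ (a + 2) ^ (i + 1) :=
      (Nat.choose_le_pow a (i + 1)).trans (Nat.pow_le_pow_left (by omega) _)
    exact_mod_cast this
  have h4 : ((a + 2).choose (i + 3) : ℝ) * ((i + 3) * (i + 2))
      ≤ ((a + 2 : ℕ) : ℝ) * ((a + 1 : ℕ) : ℝ) * ((a + 2 : ℕ) : ℝ) ^ (i + 1) := by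
    calc ((a + 2).choose (i + 3) : ℝ) * ((i + 3) * (i + 2))
        = ((a + 2 : ℕ) : ℝ) * (((a + 1).choose (i + 2) : ℝ) * (i + 2 : ℕ)) := by
          push_cast at h1 ⊢
          linear_combination -(i + 2 : ℝ) * h1
      _ = ((a + 2 : ℕ) : ℝ) * ((a + 1 : ℕ) : ℝ) * a.choose (i + 1) := by rw [← h2]; ring
      _ ≤ _ := by gcongr
  have h5 : ((a + 2).choose (i + 3) : ℝ) * 6
      ≤ ((a + 2).choose (i + 3) : ℝ) * ((i + 3) * (i + 2)) := by
    have : (0 : ℝ) ≤ i := by positivity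
    gcongr
    nlinarith
  rw [le_div_iff₀ (by norm_num), show i + 3 - 1 = i + 1 + 1 by omega, pow_succ]
  push_cast at h4 ⊢
  linarith

/-- The subsampled level is of order `γ² α x` with `x = 1/(b² σ₃²)`. -/
lemma epsPrime_le {γ σ₃ x : ℝ} {b α : ℕ} (hα : 2 ≤ α) (hγ : 0 ≤ γ)
    (hx : x = 1 / ((b : ℝ) ^ 2 * σ₃ ^ 2)) (h1 : α * x ≤ 1 / 8)
    (h2 : γ * α ≤ 1 / (2 * Real.exp 1)) (h3 : γ * α ≤ 4 * x) :
    epsPrime γ b σ₃ α ≤ 24 * γ ^ 2 * α * x := by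
  have hα2 : (2 : ℝ) ≤ α := by exact_mod_cast hα
  have hα1 : 0 < (α : ℝ) - 1 := by linarith
  have hx0 : 0 ≤ x := by rw [hx]; positivity
  have hΔ : (2 / (b * σ₃)) ^ 2 = 4 * x := by rw [hx, div_pow, mul_pow]; ring
  have hone := one_le_subsampled hγ (2 / (b * σ₃)) α
  rw [epsPrime_eq]
  set S₂ := γ ^ 2 * (α.choose 2 : ℝ) * ternaryBound (2 / (b * σ₃)) 2 with hS₂
  set S₃ := ∑ j ∈ Finset.Icc 3 α, γ ^ j * (α.choose j : ℝ) * ternaryBound (2 / (b * σ₃)) j with hS₃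
  have hlog : Real.log (1 + S₂ + S₃) ≤ S₂ + S₃ := by
    linarith [Real.log_le_sub_one_of_pos (by linarith : 0 < 1 + S₂ + S₃)]
  have b2 : S₂ ≤ ((α : ℝ) - 1) * (16 * γ ^ 2 * α * x) := by
    have ht : ternaryBound (2 / (b * σ₃)) 2 ≤ 32 * x := by
      rw [ternaryBound, if_pos rfl, hΔ]
      have hx1 : 4 * x ≤ 1 := by nlinarith
      have := Real.abs_exp_sub_one_le (x := 4 * x) (by rw [abs_of_nonneg (by positivity)]; exact hx1)
      rw [abs_of_nonneg (by positivity : 0 ≤ 4 * x)] at this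
      have := le_abs_self (Real.exp (4 * x) - 1)
      exact (min_le_left _ _).trans (by linarith)
    calc S₂ ≤ γ ^ 2 * (α.choose 2 : ℝ) * (32 * x) := by rw [hS₂]; gcongr
      _ = ((α : ℝ) - 1) * (16 * γ ^ 2 * α * x) := by rw [Nat.cast_choose_two]; ring
  -- The ratio of a geometric series that dominates the terms j ≥ 3: since (j-1)x ≤ 1/8, the factor
  -- exp(2j(j-1)x) is at most exp(1/4)^j.
  set y := γ * α * Real.exp (1 / 4) with hy
  have hy0 : 0 ≤ y := by positivity
  have hy4 : y ≤ 1 / 4 := by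
    have he : 2 ≤ Real.exp (3 / 4) := by
      have := Real.quadratic_le_exp_of_nonneg (x := 3 / 4) (by norm_num)
      linarith
    have he1 : Real.exp 1 = Real.exp (3 / 4) * Real.exp (1 / 4) := by
      rw [← Real.exp_add]; norm_num
    calc y ≤ 1 / (2 * Real.exp 1) * Real.exp (1 / 4) := by rw [hy]; gcongr
      _ = 1 / (2 * Real.exp (3 / 4)) := by
        rw [he1]
        field_simp
      _ ≤ 1 / (2 * 2) := by gcongr
      _ = 1 / 4 := by norm_num
  have b3 : S₃ ≤ ((α : ℝ) - 1) * (8 * γ ^ 2 * α * x) := by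
    have hterm : ∀ j ∈ Finset.Icc 3 α, γ ^ j * (α.choose j : ℝ) * ternaryBound (2 / (b * σ₃)) j
        ≤ ((α : ℝ) - 1) / (3 * α) * y ^ j := by
      intro j hj
      obtain ⟨hj3, hjα⟩ := Finset.mem_Icc.1 hj
      have hjα' : (j : ℝ) ≤ α := by exact_mod_cast hjα
      have ht : ternaryBound (2 / (b * σ₃)) j ≤ Real.exp (1 / 4) ^ j * 2 := by
        rw [ternaryBound, if_neg (by omega), hΔ, ← Real.exp_nat_mul]
        refine mul_le_mul_of_nonneg_right (Real.exp_le_exp.2 ?_) zero_le_two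
        have e1 : ((j : ℝ) - 1) * x ≤ α * x := by gcongr; linarith
        have e2 : (j : ℝ) * (((j : ℝ) - 1) * x) ≤ j * (1 / 8) := by gcongr; linarith
        linarith
      have hc := choose_le_of_three_le hj3 hα
      have ht0 := ternaryBound_nonneg (2 / (b * σ₃)) j
      have hαj : (α : ℝ) ^ j = α ^ (j - 1) * α := by
        rw [← pow_succ]
        congr 1
        omega
      calc _ ≤ γ ^ j * (((α : ℝ) - 1) * (α : ℝ) ^ (j - 1) / 6) * (Real.exp (1 / 4) ^ j * 2) := by
            gcongr
        _ = ((α : ℝ) - 1) / (3 * α) * y ^ j := by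
            rw [hy, mul_pow, mul_pow, hαj]
            field_simp
            ring
    have hgeom : ∑ j ∈ Finset.Icc 3 α, y ^ j ≤ y ^ 3 / (1 - y) := by
      have : Finset.Icc 3 α = Finset.Ico 3 (α + 1) := rfl
      rw [this]
      exact geom_sum_Ico_le_of_lt_one hy0 (by linarith)
    -- Here γα ≤ 4x is used: it trades one of the three factors γα for x, so that the tail is of the
    -- same order as the quadratic term. The shares 16 and 8 add up to 24.
    have hy3 : y ^ 3 / (1 - y) ≤ 24 * γ ^ 2 * α ^ 2 * x := by
      have he : Real.exp (1 / 4) ^ 3 ≤ 3 := by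
        rw [← Real.exp_nat_mul]
        have h1 : Real.exp (((3 : ℕ) : ℝ) * (1 / 4)) ≤ Real.exp 1 := by
          gcongr; norm_num
        linarith [Real.exp_one_lt_d9]
      rw [div_le_iff₀ (by linarith)]
      calc y ^ 3 = (γ * α) ^ 2 * (γ * α) * Real.exp (1 / 4) ^ 3 := by rw [hy]; ring
        _ ≤ (γ * α) ^ 2 * (4 * x) * 3 := by gcongr
        _ = 24 * γ ^ 2 * α ^ 2 * x * (1 / 2) := by ring
        _ ≤ _ := by gcongr; linarith
    calc S₃ ≤ ∑ j ∈ Finset.Icc 3 α, ((α : ℝ) - 1) / (3 * α) * y ^ j := Finset.sum_le_sum hterm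
      _ = ((α : ℝ) - 1) / (3 * α) * ∑ j ∈ Finset.Icc 3 α, y ^ j := by rw [Finset.mul_sum]
      _ ≤ ((α : ℝ) - 1) / (3 * α) * (24 * γ ^ 2 * α ^ 2 * x) := by
          gcongr
          exact hgeom.trans hy3
      _ = _ := by
          field_simp
          ring
  rw [one_div, inv_mul_le_iff₀ hα1]
  linarith

lemma ceil_div_le_two_mul {N m : ℕ} (hm : 1 ≤ m) (h : m ≤ N) :
    (⌈(N : ℝ) / m⌉ : ℝ) ≤ 2 * (N / m) := by
  have hm0 : (0 : ℝ) < m := by exact_mod_cast hm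
  have h1 : (1 : ℝ) ≤ N / m := by
    rw [le_div_iff₀ hm0, one_mul]
    exact_mod_cast h
  linarith [Int.ceil_lt_add_one ((N : ℝ) / m)]

/-- The witness is k = ⌈N/2⌉ ≥ ⌈N/m⌉. For N ≥ 2 it is at most 3N/4, with N = 3 the tight odd case up
to rounding. -/
lemma quarter_le_sub_ceil_div {N m : ℕ} (hm : 2 ≤ m) (h : m ≤ N) :
    (N : ℝ) / 4 ≤ N - (⌈(N : ℝ) / m⌉ : ℝ) := by
  obtain ⟨k, h1, h2⟩ : ∃ k : ℕ, N ≤ 2 * k ∧ 4 * k ≤ 3 * N :=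
    ⟨(N + 1) / 2, by omega, by omega⟩
  have h1' : (N : ℝ) ≤ 2 * k := by exact_mod_cast h1
  have h2' : 4 * (k : ℝ) ≤ 3 * N := by exact_mod_cast h2
  have hceil : ⌈(N : ℝ) / m⌉ ≤ (k : ℤ) := by
    refine Int.ceil_le.2 ?_
    push_cast
    calc (N : ℝ) / m ≤ N / 2 := by
          gcongr
          exact_mod_cast hm
      _ ≤ k := by linarith
  have hceil' : (⌈(N : ℝ) / m⌉ : ℝ) ≤ k := by exact_mod_cast hceil
  linarith

/-- The order of `α = 1 + ⌈2 log(1/δ)/ε⌉`. -/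
lemma order_bounds {ε εmax δ δmax : ℝ} (hε : 0 < ε) (hε1 : ε ≤ εmax) (hδ : 0 < δ) (hδ1 : δ ≤ δmax)
    (hδ2 : δmax < 1) {α : ℕ} (hα : α = 1 + ⌈2 * Real.log (1 / δ) / ε⌉₊) :
    2 ≤ α ∧ 2 * Real.log (1 / δ) ≤ α * ε ∧
      α * ε ≤ (2 + 2 * εmax / Real.log (1 / δmax)) * Real.log (1 / δ) := by
  have hδ0 : 0 < δmax := hδ.trans_le hδ1
  have hL0 : 0 < Real.log (1 / δmax) := Real.log_pos (by rw [lt_div_iff₀ hδ0]; linarith)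
  have hL : Real.log (1 / δmax) ≤ Real.log (1 / δ) := by gcongr
  have hc : 0 < 2 * Real.log (1 / δ) / ε := by
    have := hL0.trans_le hL
    positivity
  have h1 := Nat.le_ceil (2 * Real.log (1 / δ) / ε)
  have h2 := Nat.ceil_lt_add_one hc.le
  have h3 := Nat.ceil_pos.2 hc
  have hα' : (α : ℝ) = 1 + ⌈2 * Real.log (1 / δ) / ε⌉₊ := by rw [hα]; push_cast; ring
  refine ⟨by omega, ?_, ?_⟩
  · rw [div_le_iff₀ hε] at h1
    nlinarith
  · have h4 : (α : ℝ) * ε ≤ (2 + 2 * Real.log (1 / δ) / ε) * ε := by gcongr; linarith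
    have h5 : (2 + 2 * Real.log (1 / δ) / ε) * ε = 2 * ε + 2 * Real.log (1 / δ) := by field_simp
    -- The rounding error in α contributes a term of order ε, which is absorbed into log(1/δ)
    -- because ε is bounded above and log(1/δ) is bounded below.
    have h6 : εmax ≤ εmax / Real.log (1 / δmax) * Real.log (1 / δ) := by
      rw [div_mul_eq_mul_div, le_div_iff₀ hL0]
      have := hε.trans_le hε1
      gcongr
    have h7 : 2 * εmax / Real.log (1 / δmax) = 2 * (εmax / Real.log (1 / δmax)) := by ring
    rw [h7]
    linarith

section Calibration

variable {d P : ℕ} {n : Fin P → ℕ} {Z : Type*}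

/-- The condition on the local noise, from a lower bound on `σ₃` and an upper bound on `b`. -/
lemma local_condition [NeZero P] (A : Config d n Z) {θ ε σ₃ : ℝ} {α : ℕ} (hα : 2 ≤ α) (hθ : 0 < θ)
    (hε : 0 < ε) (hP : P ≤ A.R) (hσ₃ : 0 < σ₃)
    (h1 : α * (96 * (A.K * A.R) / ((nMin n : ℝ) ^ 2 * P * θ * ε)) ≤ σ₃ ^ 2)
    (h2 : α * (8 / (A.b : ℝ) ^ 2) ≤ σ₃ ^ 2)
    (hb : (A.b : ℝ) ≤ min ((nMin n : ℝ) / (2 * Real.exp 1 * α))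
      ((4 * (nMin n : ℝ) / (α * σ₃ ^ 2)) ^ (1 / 3 : ℝ))) :
    2 * (A.K : ℝ) * (⌈(A.R : ℝ) / P⌉ : ℝ) * epsPrime ((A.b : ℝ) / nMin n) A.b σ₃ α ≤ θ * ε := by
  have hα0 : (0 : ℝ) < α := by positivity
  have hP0 : (0 : ℝ) < P := by exact_mod_cast NeZero.pos P
  have hb0 : (0 : ℝ) < A.b := by exact_mod_cast A.b_pos
  have hn : (0 : ℝ) < nMin n := by exact_mod_cast A.b_pos.trans A.b_le_nMin
  obtain ⟨hb1, hb2⟩ := le_min_iff.1 hb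
  have hb3 : (A.b : ℝ) ^ 3 ≤ 4 * nMin n / (α * σ₃ ^ 2) := by
    calc (A.b : ℝ) ^ 3 ≤ ((4 * (nMin n : ℝ) / (α * σ₃ ^ 2)) ^ (1 / 3 : ℝ)) ^ 3 := by gcongr
      _ = 4 * nMin n / (α * σ₃ ^ 2) := by
        rw [← Real.rpow_natCast, ← Real.rpow_mul (by positivity)]
        norm_num
  have hε' : epsPrime ((A.b : ℝ) / nMin n) A.b σ₃ α
      ≤ 24 * ((A.b : ℝ) / nMin n) ^ 2 * α * (1 / ((A.b : ℝ) ^ 2 * σ₃ ^ 2)) := by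
    -- The three conditions are, in order, the second lower bound on σ₃², the first bound on b, and
    -- the cubic bound on b, which says bα/n_min ≤ 4/(b² σ₃²).
    refine epsPrime_le hα (by positivity) rfl ?_ ?_ ?_
    · rw [mul_div_assoc', div_le_iff₀ (by positivity)] at h2
      rw [mul_one_div, div_le_iff₀ (by positivity)]
      linarith
    · rw [le_div_iff₀ (by positivity)] at hb1 ⊢
      rw [div_mul_eq_mul_div, div_mul_eq_mul_div, div_le_one hn]
      linarith
    · rw [le_div_iff₀ (by positivity)] at hb3
      rw [div_mul_eq_mul_div, mul_one_div, div_le_div_iff₀ hn (by positivity)]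
      linarith
  have hceil : (⌈(A.R : ℝ) / P⌉ : ℝ) ≤ 2 * (A.R / P) := ceil_div_le_two_mul (NeZero.pos P) hP
  have hceil0 : (0 : ℝ) ≤ (⌈(A.R : ℝ) / P⌉ : ℝ) := by exact_mod_cast Int.ceil_nonneg (by positivity)
  -- The minibatch size cancels between (b/n_min)² and 1/(b² σ₃²), and 96 = 2 · 2 · 24.
  calc 2 * (A.K : ℝ) * (⌈(A.R : ℝ) / P⌉ : ℝ) * epsPrime ((A.b : ℝ) / nMin n) A.b σ₃ α
      ≤ 2 * (A.K : ℝ) * (2 * (A.R / P))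
        * (24 * ((A.b : ℝ) / nMin n) ^ 2 * α * (1 / ((A.b : ℝ) ^ 2 * σ₃ ^ 2))) := by
        gcongr
        exact epsPrime_nonneg (by positivity) _ _ hα
    _ = α * (96 * (A.K * A.R) / ((nMin n : ℝ) ^ 2 * P * θ * ε)) * (θ * ε) / σ₃ ^ 2 := by
      field_simp
      ring
    _ ≤ σ₃ ^ 2 * (θ * ε) / σ₃ ^ 2 := by gcongr
    _ = θ * ε := by field_simp

/-- Each squared noise level is αε times the asserted rate, up to constants, and αε lies between 2L
and ML. The choice s₃² = α max(96Q/(θε), 8/b²) takes the larger of the two lower bounds needed by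
`local_condition`; as θ ≤ 1, the constant 96M/θ covers both branches from above. -/
lemma exists_noise_levels [NeZero P] (A : Config d n Z) {u₁ u₂ ε δ L M : ℝ} {α : ℕ}
    (hu₁ : 1 < u₁) (hu₂ : 1 < u₂) (hθ : 0 < 1 - 1 / u₁ - 1 / u₂) (hε : 0 < ε) (hδ : 0 < δ)
    (hδ1 : δ < 1) (hL : L = Real.log (1 / δ)) (hTR : A.T ≤ A.R) (hPR : P ≤ A.R)
    (hα : α = 1 + ⌈2 * Real.log (1 / δ) / ε⌉₊) (hα2 : 2 ≤ α) (hαl : 2 * L ≤ α * ε)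
    (hαu : α * ε ≤ M * L) :
    ∃ σ₁ σ₂ s₃ : ℝ, 0 < σ₁ ∧ 0 ≤ σ₂ ∧ 0 < s₃ ∧
      σ₁ ^ 2 = 4 * u₁ * α * (⌈(A.R : ℝ) / A.T⌉ : ℝ)
        / ((nMin n : ℝ) ^ 2 * (P : ℝ) ^ 2 * ε) ∧
      σ₂ ^ 2 = 4 * u₂ * α * ((A.R : ℝ) - (⌈(A.R : ℝ) / A.T⌉ : ℝ))
        / ((nMin n : ℝ) ^ 2 * (P : ℝ) ^ 2 * ε) ∧
      L * ((A.R : ℝ) / (A.T * (nMin n : ℝ) ^ 2 * (P : ℝ) ^ 2 * ε ^ 2)) ≤ σ₁ ^ 2 ∧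
      σ₁ ^ 2 ≤ 8 * u₁ * M * L
          * ((A.R : ℝ) / (A.T * (nMin n : ℝ) ^ 2 * (P : ℝ) ^ 2 * ε ^ 2)) ∧
      (2 ≤ A.T → L * ((A.R : ℝ) / ((nMin n : ℝ) ^ 2 * (P : ℝ) ^ 2 * ε ^ 2)) ≤ σ₂ ^ 2) ∧
      σ₂ ^ 2 ≤ 4 * u₂ * M * L * ((A.R : ℝ) / ((nMin n : ℝ) ^ 2 * (P : ℝ) ^ 2 * ε ^ 2)) ∧
      L * max ((A.K : ℝ) * A.R / ((nMin n : ℝ) ^ 2 * P * ε ^ 2)) (1 / ((A.b : ℝ) ^ 2 * ε))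
        ≤ s₃ ^ 2 ∧
      s₃ ^ 2 ≤ 96 * M / (1 - 1 / u₁ - 1 / u₂) * L
          * max ((A.K : ℝ) * A.R / ((nMin n : ℝ) ^ 2 * P * ε ^ 2)) (1 / ((A.b : ℝ) ^ 2 * ε)) ∧
      ∀ σ₃ : ℝ, s₃ ≤ σ₃ →
        (A.b : ℝ) ≤ min ((nMin n : ℝ) / (2 * Real.exp 1 * α))
          ((4 * (nMin n : ℝ) / (α * σ₃ ^ 2)) ^ (1 / 3 : ℝ)) →
        2 * (A.K : ℝ) * (⌈(A.R : ℝ) / P⌉ : ℝ) * epsPrime ((A.b : ℝ) / nMin n) A.b σ₃ α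
          ≤ (1 - 1 / u₁ - 1 / u₂) * ε ∧
        ∀ p : Fin P, IsDP (mechanism A σ₁ σ₂ σ₃) p ε δ := by
  set θ := 1 - 1 / u₁ - 1 / u₂ with hθdef
  have hu₁0 : 0 < u₁ := by linarith
  have hu₂0 : 0 < u₂ := by linarith
  have hθ1 : θ ≤ 1 := by
    have : 0 < 1 / u₁ := by positivity
    have : 0 < 1 / u₂ := by positivity
    linarith
  have hL0 : 0 < L := by rw [hL]; exact Real.log_pos (by rw [lt_div_iff₀ hδ]; linarith)
  have hα0 : (0 : ℝ) < α := by positivity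
  have hP0 : (0 : ℝ) < P := by exact_mod_cast NeZero.pos P
  have hb0 : (0 : ℝ) < A.b := by exact_mod_cast A.b_pos
  have hR0 : (0 : ℝ) < A.R := by exact_mod_cast A.R_pos
  have hT0 : (0 : ℝ) < A.T := by exact_mod_cast A.T_pos
  have hK0 : (0 : ℝ) < A.K := by exact_mod_cast A.K_pos
  have hn : (0 : ℝ) < nMin n := by exact_mod_cast A.b_pos.trans A.b_le_nMin
  have hc1 : (A.R : ℝ) / A.T ≤ (⌈(A.R : ℝ) / A.T⌉ : ℝ) := Int.le_ceil _
  have hc1' : (⌈(A.R : ℝ) / A.T⌉ : ℝ) ≤ 2 * (A.R / A.T) := ceil_div_le_two_mul A.T_pos hTR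
  have hc2 : (0 : ℝ) ≤ (A.R : ℝ) - (⌈(A.R : ℝ) / A.T⌉ : ℝ) := sub_nonneg.2 (ceil_div_le A.T_pos)
  have hc0 : (0 : ℝ) < (⌈(A.R : ℝ) / A.T⌉ : ℝ) := lt_of_lt_of_le (by positivity) hc1
  have hc2' : (A.R : ℝ) - (⌈(A.R : ℝ) / A.T⌉ : ℝ) ≤ A.R := by linarith
  have hM0 : 0 < M := by
    by_contra! hM
    linarith [mul_pos hα0 hε, mul_nonpos_of_nonpos_of_nonneg hM hL0.le]
  have hquarter : 2 ≤ A.T → (A.R : ℝ) / 4 ≤ A.R - (⌈(A.R : ℝ) / A.T⌉ : ℝ) :=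
    fun h => quarter_le_sub_ceil_div h hTR
  set c₁ := (⌈(A.R : ℝ) / A.T⌉ : ℝ)
  set W := 1 / ((nMin n : ℝ) ^ 2 * (P : ℝ) ^ 2 * ε ^ 2) with hW
  have hW0 : 0 < W := by positivity
  have f1 : 4 * u₁ * α * c₁ / ((nMin n : ℝ) ^ 2 * (P : ℝ) ^ 2 * ε)
      = 4 * u₁ * (α * ε) * c₁ * W := by rw [hW]; field_simp
  have f2 : 4 * u₂ * α * (A.R - c₁) / ((nMin n : ℝ) ^ 2 * (P : ℝ) ^ 2 * ε)
      = 4 * u₂ * (α * ε) * (A.R - c₁) * W := by rw [hW]; field_simp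
  have f3 : (A.R : ℝ) / (A.T * (nMin n : ℝ) ^ 2 * (P : ℝ) ^ 2 * ε ^ 2) = A.R / A.T * W := by
    rw [hW]; field_simp
  have f4 : (A.R : ℝ) / ((nMin n : ℝ) ^ 2 * (P : ℝ) ^ 2 * ε ^ 2) = A.R * W := by
    rw [hW]; field_simp
  rw [f1, f2, f3, f4]
  set Q := (A.K : ℝ) * A.R / ((nMin n : ℝ) ^ 2 * P) with hQ
  have hQ0 : 0 < Q := by positivity
  have f5 : (A.K : ℝ) * A.R / ((nMin n : ℝ) ^ 2 * P * ε ^ 2) = Q / ε ^ 2 := by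
    rw [hQ]; field_simp
  have f6 : 96 * (A.K * A.R) / ((nMin n : ℝ) ^ 2 * P * θ * ε) = 96 * Q / (θ * ε) := by
    rw [hQ]; field_simp
  rw [f5]
  have hs : 0 < (α : ℝ) * max (96 * Q / (θ * ε)) (8 / (A.b : ℝ) ^ 2) :=
    mul_pos hα0 (lt_max_of_lt_right (by positivity))
  have hσ₁ : 0 < 4 * u₁ * (α * ε) * c₁ * W := by positivity
  have hσ₂ : 0 ≤ 4 * u₂ * (α * ε) * (A.R - c₁) * W := by positivity
  have g1 : (α : ℝ) * (96 * Q / (θ * ε)) = 96 / θ * (α * ε) * (Q / ε ^ 2) := by field_simp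
  have g2 : (α : ℝ) * (8 / (A.b : ℝ) ^ 2) = 8 * (α * ε) * (1 / ((A.b : ℝ) ^ 2 * ε)) := by field_simp
  have h96 : 96 ≤ 96 / θ := by rw [le_div_iff₀ hθ]; linarith
  have hLα : L ≤ α * ε := by linarith
  refine ⟨√(4 * u₁ * (α * ε) * c₁ * W), √(4 * u₂ * (α * ε) * (A.R - c₁) * W),
    √(α * max (96 * Q / (θ * ε)) (8 / (A.b : ℝ) ^ 2)), Real.sqrt_pos.2 hσ₁, Real.sqrt_nonneg _,
    Real.sqrt_pos.2 hs, Real.sq_sqrt hσ₁.le, Real.sq_sqrt hσ₂, ?_, ?_, ?_, ?_, ?_, ?_, ?_⟩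
  · rw [Real.sq_sqrt hσ₁.le]
    calc L * (A.R / A.T * W) ≤ (α * ε) * (c₁ * W) := by gcongr
      _ = 1 * (α * ε) * c₁ * W := by ring
      _ ≤ _ := by gcongr; linarith
  · rw [Real.sq_sqrt hσ₁.le]
    calc 4 * u₁ * (α * ε) * c₁ * W ≤ 4 * u₁ * (M * L) * (2 * (A.R / A.T)) * W := by gcongr
      _ = _ := by ring
  · intro hT2
    rw [Real.sq_sqrt hσ₂]
    have := hquarter hT2
    calc L * (A.R * W) = 4 * 1 * L * (A.R / 4) * W := by ring
      _ ≤ _ := by gcongr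
  · rw [Real.sq_sqrt hσ₂]
    calc 4 * u₂ * (α * ε) * (A.R - c₁) * W ≤ 4 * u₂ * (M * L) * A.R * W := by gcongr
      _ = _ := by ring
  · rw [Real.sq_sqrt hs.le, mul_max_of_nonneg _ _ hL0.le, mul_max_of_nonneg _ _ hα0.le, g1, g2]
    refine max_le_max ?_ ?_
    · gcongr
      calc L ≤ 1 * (α * ε) := by linarith
        _ ≤ 96 / θ * (α * ε) := by gcongr; linarith
    · gcongr
      linarith
  · rw [Real.sq_sqrt hs.le, mul_max_of_nonneg _ _ hα0.le,
      mul_max_of_nonneg _ _ (by positivity : 0 ≤ 96 * M / θ * L), g1, g2]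
    have e : 96 * M / θ * L = 96 / θ * (M * L) := by ring
    rw [e]
    refine max_le_max ?_ ?_
    · gcongr
    · gcongr
      linarith
  · intro σ₃ hσ₃ hb
    have hσ₃0 : 0 < σ₃ := (Real.sqrt_pos.2 hs).trans_le hσ₃
    have hsq : (α : ℝ) * max (96 * Q / (θ * ε)) (8 / (A.b : ℝ) ^ 2) ≤ σ₃ ^ 2 := by
      rw [← Real.sq_sqrt hs.le]
      gcongr
    have hcond := local_condition A hα2 hθ hε hPR hσ₃0
      (by rw [f6]; exact (by gcongr; exact le_max_left _ _ : _ ≤ _).trans hsq)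
      ((by gcongr; exact le_max_right _ _ : _ ≤ _).trans hsq) hb
    refine ⟨hcond, isDP_of_noise A hu₁ hu₂ hε hδ hδ1 (Real.sqrt_nonneg _) (Real.sqrt_nonneg _) hσ₃0
      hα ((Real.sq_sqrt hσ₁.le).trans f1.symm) ((Real.sq_sqrt hσ₂).trans f2.symm) hcond⟩

end Calibration

end DIFF2

/-! ### Assembly of the three statements -/

theorem mainTheorem3 :
    -- the privacy level for given noise multipliers
    (∀ (d P : ℕ) [NeZero P] (n : Fin P → ℕ) (Z : Type u) (A : DIFF2.Config d n Z)
        (σ₁ σ₂ σ₃ δ : ℝ) (α : ℕ),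
      0 < σ₁ → 0 < σ₂ → 0 < σ₃ → 0 < δ → δ < 1 → 2 ≤ α →
      ∀ p : Fin P, DIFF2.IsDP (DIFF2.mechanism A σ₁ σ₂ σ₃) p
        (2 * (α : ℝ) * (⌈(A.R : ℝ) / A.T⌉ : ℝ) / ((n p : ℝ) ^ 2 * (P : ℝ) ^ 2 * σ₁ ^ 2)
          + 2 * (α : ℝ) * ((A.R : ℝ) - (⌈(A.R : ℝ) / A.T⌉ : ℝ))
              / ((n p : ℝ) ^ 2 * (P : ℝ) ^ 2 * σ₂ ^ 2)
          + (A.K : ℝ) * (⌈(A.R : ℝ) / P⌉ : ℝ)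
              * DIFF2.epsPrime ((A.b : ℝ) / n p) A.b σ₃ α
          + Real.log (1 / δ) / ((α : ℝ) - 1)) δ) ∧
    -- the sufficient condition for a prescribed privacy level
    (∀ (d P : ℕ) [NeZero P] (n : Fin P → ℕ) (Z : Type u) (A : DIFF2.Config d n Z)
        (u₁ u₂ ε δ σ₁ σ₂ σ₃ : ℝ) (α : ℕ),
      1 < u₁ → 1 < u₂ → 0 < ε → 0 < δ → δ < 1 → 0 ≤ σ₁ → 0 ≤ σ₂ → 0 < σ₃ →
      α = 1 + ⌈2 * Real.log (1 / δ) / ε⌉₊ →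
      σ₁ ^ 2 = 4 * u₁ * α * (⌈(A.R : ℝ) / A.T⌉ : ℝ)
        / ((DIFF2.nMin n : ℝ) ^ 2 * (P : ℝ) ^ 2 * ε) →
      σ₂ ^ 2 = 4 * u₂ * α * ((A.R : ℝ) - (⌈(A.R : ℝ) / A.T⌉ : ℝ))
        / ((DIFF2.nMin n : ℝ) ^ 2 * (P : ℝ) ^ 2 * ε) →
      2 * (A.K : ℝ) * (⌈(A.R : ℝ) / P⌉ : ℝ)
          * DIFF2.epsPrime ((A.b : ℝ) / DIFF2.nMin n) A.b σ₃ α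
        ≤ (1 - 1 / u₁ - 1 / u₂) * ε →
      ∀ p : Fin P, DIFF2.IsDP (DIFF2.mechanism A σ₁ σ₂ σ₃) p ε δ) ∧
    -- the order of the noise levels; the constants depend only on `u₁, u₂, εmax, δmax`
    (∀ u₁ u₂ εmax δmax : ℝ, 1 < u₁ → 1 < u₂ → 1 / u₁ + 1 / u₂ < 1 →
        0 < εmax → 0 < δmax → δmax < 1 →
      ∃ c C : ℝ, 0 < c ∧ 0 < C ∧
        ∀ (d P : ℕ) [NeZero P] (n : Fin P → ℕ) (Z : Type u) (A : DIFF2.Config d n Z)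
          (ε δ : ℝ) (α : ℕ),
        0 < ε → ε ≤ εmax → 0 < δ → δ ≤ δmax → A.T ≤ A.R → P ≤ A.R →
        α = 1 + ⌈2 * Real.log (1 / δ) / ε⌉₊ →
        ∃ σ₁ σ₂ s₃ : ℝ, 0 < σ₁ ∧ 0 ≤ σ₂ ∧ 0 < s₃ ∧
          σ₁ ^ 2 = 4 * u₁ * α * (⌈(A.R : ℝ) / A.T⌉ : ℝ)
            / ((DIFF2.nMin n : ℝ) ^ 2 * (P : ℝ) ^ 2 * ε) ∧
          σ₂ ^ 2 = 4 * u₂ * α * ((A.R : ℝ) - (⌈(A.R : ℝ) / A.T⌉ : ℝ))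
            / ((DIFF2.nMin n : ℝ) ^ 2 * (P : ℝ) ^ 2 * ε) ∧
          c * Real.log (1 / δ)
              * ((A.R : ℝ) / (A.T * (DIFF2.nMin n : ℝ) ^ 2 * (P : ℝ) ^ 2 * ε ^ 2)) ≤ σ₁ ^ 2 ∧
          σ₁ ^ 2 ≤ C * Real.log (1 / δ)
              * ((A.R : ℝ) / (A.T * (DIFF2.nMin n : ℝ) ^ 2 * (P : ℝ) ^ 2 * ε ^ 2)) ∧
          (2 ≤ A.T → c * Real.log (1 / δ)
              * ((A.R : ℝ) / ((DIFF2.nMin n : ℝ) ^ 2 * (P : ℝ) ^ 2 * ε ^ 2)) ≤ σ₂ ^ 2) ∧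
          σ₂ ^ 2 ≤ C * Real.log (1 / δ)
              * ((A.R : ℝ) / ((DIFF2.nMin n : ℝ) ^ 2 * (P : ℝ) ^ 2 * ε ^ 2)) ∧
          c * Real.log (1 / δ)
              * max ((A.K : ℝ) * A.R / ((DIFF2.nMin n : ℝ) ^ 2 * P * ε ^ 2))
                  (1 / ((A.b : ℝ) ^ 2 * ε)) ≤ s₃ ^ 2 ∧
          s₃ ^ 2 ≤ C * Real.log (1 / δ)
              * max ((A.K : ℝ) * A.R / ((DIFF2.nMin n : ℝ) ^ 2 * P * ε ^ 2))
                  (1 / ((A.b : ℝ) ^ 2 * ε)) ∧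
          -- every `σ₃ ≥ s₃`, in particular `σ₃ = s₃`, will do
          ∀ σ₃ : ℝ, s₃ ≤ σ₃ →
            (A.b : ℝ) ≤ min ((DIFF2.nMin n : ℝ) / (2 * Real.exp 1 * α))
              ((4 * (DIFF2.nMin n : ℝ) / (α * σ₃ ^ 2)) ^ (1 / 3 : ℝ)) →
            2 * (A.K : ℝ) * (⌈(A.R : ℝ) / P⌉ : ℝ)
                * DIFF2.epsPrime ((A.b : ℝ) / DIFF2.nMin n) A.b σ₃ α
              ≤ (1 - 1 / u₁ - 1 / u₂) * ε ∧
            ∀ p : Fin P, DIFF2.IsDP (DIFF2.mechanism A σ₁ σ₂ σ₃) p ε δ) := by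
  refine ⟨?_, ?_, ?_⟩
  · intro d P _ n Z A σ₁ σ₂ σ₃ δ α hσ₁ hσ₂ hσ₃ hδ _ hα p
    exact DIFF2.isDP_mechanism A hσ₁ (fun _ _ _ => hσ₂) hσ₃ hδ hα p
  · intro d P _ n Z A u₁ u₂ ε δ σ₁ σ₂ σ₃ α hu₁ hu₂ hε hδ hδ1 hσ₁ hσ₂ hσ₃ hα h₁ h₂ h₃ p
    exact DIFF2.isDP_of_noise A hu₁ hu₂ hε hδ hδ1 hσ₁ hσ₂ hσ₃ hα h₁ h₂ h₃ p
  · intro u₁ u₂ εmax δmax hu₁ hu₂ hu hεmax hδmax hδmax1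
    have hθ : 0 < 1 - 1 / u₁ - 1 / u₂ := by linarith
    have hu₁0 : 0 < u₁ := by linarith
    have hu₂0 : 0 < u₂ := by linarith
    have hL0 : 0 < Real.log (1 / δmax) := Real.log_pos (by rw [lt_div_iff₀ hδmax]; linarith)
    -- M is the factor in αε ≤ M log(1/δ). It is fixed before the algorithm and its data are
    -- introduced, so C depends on u₁, u₂, εmax, δmax only; the lower constant can be 1.
    obtain ⟨M, hM⟩ : ∃ M, M = 2 + 2 * εmax / Real.log (1 / δmax) := ⟨_, rfl⟩
    have hM0 : 0 < M := by rw [hM]; positivity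
    obtain ⟨C, hC₁, hC₂, hC₃⟩ : ∃ C, 8 * u₁ * M ≤ C ∧ 4 * u₂ * M ≤ C ∧
        96 * M / (1 - 1 / u₁ - 1 / u₂) ≤ C :=
      ⟨max (8 * u₁ * M) (max (4 * u₂ * M) (96 * M / (1 - 1 / u₁ - 1 / u₂))), le_max_left _ _,
        (le_max_left _ _).trans (le_max_right _ _), (le_max_right _ _).trans (le_max_right _ _)⟩
    refine ⟨1, C, one_pos, lt_of_lt_of_le (by positivity) hC₁, ?_⟩
    intro d P _ n Z A ε δ α hε hε1 hδ hδ1 hTR hPR hα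
    have hδ2 : δ < 1 := hδ1.trans_lt hδmax1
    obtain ⟨hα2, hαl, hαu⟩ := DIFF2.order_bounds hε hε1 hδ hδ1 hδmax1 hα
    rw [← hM] at hαu
    have hL : 0 < Real.log (1 / δ) := Real.log_pos (by rw [lt_div_iff₀ hδ]; linarith)
    obtain ⟨σ₁, σ₂, s₃, h1, h2, h3, h4, h5, h6, h7, h8, h9, h10, h11, h12⟩ :=
      DIFF2.exists_noise_levels A hu₁ hu₂ hθ hε hδ hδ2 rfl hTR hPR hα hα2 hαl hαu
    refine ⟨σ₁, σ₂, s₃, h1, h2, h3, h4, h5, ?_, h7.trans ?_, ?_, h9.trans ?_, ?_, h11.trans ?_, h12⟩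
    · rwa [one_mul]
    · gcongr
    · rwa [one_mul]
    · gcongr
    · rwa [one_mul]
    · gcongr
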